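/- Conventions. An operator system is a norm closed, self-adjoint subspace of a unital $C^*$-algebra containing its unit. All completely positive maps are assumed unital. A complete order injection is an injective unital completely positive map which is a complete order isomorphism onto its range. Let $\mathcal G$ be a (discrete) groupoid with unit space $\mathcal G^{(0)}$, source and range maps $d,r$, and $\mathcal G^u=r^{-1}(u)$. A groupoid dynamical system $\mathcal A=(\mathcal G,\{A_u\}_{u\in\mathcal G^{(0)}},\alpha)$ consists of operator systems $A_u$ and (unital) complete order isomorphisms $\alpha_g:A_{d(g)}\to A_{r(g)}$, written $a\mapsto g\cdot a$, with $\alpha_g\alpha_h=\alpha_{gh}$ for composable $g,h$. A $\mathcal G$-morphism $\Phi=\{\varphi_u\}:\mathcal A\to\mathcal B$ is a family of completely positive maps $\varphi_u:A_u\to B_u$ with $\beta_g\varphi_{d(g)}=\varphi_{r(g)}\alpha_g$. It is a $\mathcal G$-injection ($\mathcal G$-embedding) if every $\varphi_u$ is a complete order injection, and a $\mathcal G$-isomorphism if every $\varphi_u$ is a complete order isomorphism. A $\mathcal G$-extension of $\mathcal A$ is a pair $(\mathcal W,\Theta)$ with $\Theta:\mathcal A\to\mathcal W$ a $\mathcal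 G$-embedding. It is $\mathcal G$-essential if every $\mathcal G$-morphism $\Phi:\mathcal W\to\mathcal C$ for which $\Phi\circ\Theta$ is a $\mathcal G$-injection is itself a $\mathcal G$-injection, and $\mathcal G$-rigid if the identity is the only $\mathcal G$-morphism $\Phi:\mathcal W\to\mathcal W$ with $\Phi\circ\Theta=\Theta$. A system $\mathcal W$ is $\mathcal G$-injective if for every $\mathcal G$-injection $\Phi:\mathcal A\to\mathcal B$ and every $\mathcal G$-morphism $\Psi:\mathcal A\to\mathcal W$ there is a $\mathcal G$-morphism $\Theta:\mathcal B\to\mathcal W$ with $\Theta\circ\Phi=\Psi$. A $\mathcal G$-injective envelope of $\mathcal A$ is a $\mathcal G$-extension $(\mathcal I,\Upsilon)$ with $\mathcal I$ $\mathcal G$-injective that is minimal: the only $\mathcal G$-injective dynamical subsystem of $\mathcal I$ containing $\Upsilon(\mathcal A)$ is $\mathcal I$ itself. Theorem. Let $\mathcal A=(\mathcal G,\{A_u\},\alpha)$ be a groupoid dynamical system. 1. $\mathcal A$ has a $\mathcal G$-injective envelope $(I_{\mathcal G}(\mathcal A),\Upsilon)$. 2. It is unique up to $\mathcal G$-isomorphism: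 if $(\mathcal I,\Upsilon)$ and $(\mathcal B,\Phi)$ are $\mathcal G$-injective envelopes of $\mathcal A$, there is a $\mathcal G$-isomorphism $\Psi:\mathcal I\to\mathcal B$ with $\Psi\circ\Upsilon=\Phi$. 3. For a $\mathcal G$-extension $(\mathcal B,\Phi)$ of $\mathcal A$ with $\mathcal B$ $\mathcal G$-injective, the following are equivalent: $(\mathcal B,\Phi)$ is a $\mathcal G$-injective envelope of $\mathcal A$; it is $\mathcal G$-essential; it is $\mathcal G$-rigid. 4. If all $A_u$ are nonzero, there are a Hilbert space $H$ and complete order injections $\iota_u:A_u\to B(H)$, $u\in\mathcal G^{(0)}$. For any $\mathcal A$ and any such $H$ and $\{\iota_u\}$, let $\mathcal W=(\mathcal G,\{\ell^\infty(\mathcal G^u,B(H))\}_u,\ell)$ with $\ell_g(f)(h)=f(g^{-1}h)$, and let $J_u(a)(g)=\iota_{d(g)}(g^{-1}\cdot a)$ for $a\in A_u$, $g\in\mathcal G^u$. Then $J=\{J_u\}$ is a $\mathcal G$-embedding of $\mathcal A$ into $\mathcal W$. Call a $\mathcal G$-morphism $\Theta:\mathcal W\to\mathcal W$ an $\mathcal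 A$-projection if $\Theta\circ\Theta=\Theta$ and $\Theta\circ J=J$, and order the $\mathcal A$-projections by $\Phi\preceq\Theta$ iff $\Theta\circ\Phi=\Phi\circ\Theta=\Phi$. There is a minimal $\mathcal A$-projection on $\mathcal W$, and for every minimal $\mathcal A$-projection $\Theta=\{\theta_u\}$ the ranges $\theta_u(\ell^\infty(\mathcal G^u,B(H)))$ form a dynamical subsystem of $\mathcal W$ which, together with $J$ viewed as a map into it, is a $\mathcal G$-injective envelope of $\mathcal A$. -/

import Mathlib

open CategoryTheory
open scoped BoundedContinuousFunction

universe u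

noncomputable section

/-- An operator system: a norm closed, self-adjoint linear subspace of a unital C*-algebra that
contains the unit of that algebra. -/
structure OperatorSystem : Type (u + 1) where
  /-- The ambient unital C*-algebra. -/
  Ambient : Type u
  [cstar : CStarAlgebra Ambient]
  /-- The underlying linear subspace. -/
  carrier : Submodule ℂ Ambient
  isClosed : IsClosed (carrier : Set Ambient)
  star_mem : ∀ x ∈ carrier, star x ∈ carrier
  one_mem : (1 : Ambient) ∈ carrier

namespace OperatorSystem

attribute [instance] OperatorSystem.cstar

instance : CoeSort OperatorSystem.{u} (Type u) := ⟨fun A => A.carrier⟩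

instance (A : OperatorSystem.{u}) : One A := ⟨⟨1, A.one_mem⟩⟩

/-- A matrix over an operator system is positive if it is a positive element of the C*-algebra of
matrices over the ambient C*-algebra, that is, if it is of the form `N* N` there. -/
def MatPos (A : OperatorSystem.{u}) {n : ℕ} (M : Matrix (Fin n) (Fin n) A) : Prop :=
  ∃ N : Matrix (Fin n) (Fin n) A.Ambient,
    M.map (fun x : A => (x : A.Ambient)) = N.conjTranspose * N

/-- A unital C*-algebra, viewed as an operator system. -/
def ofCStarAlgebra (B : Type u) [CStarAlgebra B] : OperatorSystem.{u} where
  Ambient := B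
  carrier := ⊤
  isClosed := isClosed_univ
  star_mem := fun _ _ => Submodule.mem_top
  one_mem := Submodule.mem_top

end OperatorSystem

/-- Unital completely positive maps between operator systems. -/
structure UCPMap (A B : OperatorSystem.{u}) where
  /-- The underlying linear map. -/
  toLin : A →ₗ[ℂ] B
  map_one : toLin 1 = 1
  map_matPos : ∀ (n : ℕ) (M : Matrix (Fin n) (Fin n) A), A.MatPos M → B.MatPos (M.map toLin)

namespace UCPMap

instance (A B : OperatorSystem.{u}) : CoeFun (UCPMap A B) (fun _ => A → B) := ⟨fun f => f.toLin⟩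

/-- The composition `f ∘ g` of unital completely positive maps. -/
def comp {A B C : OperatorSystem.{u}} (f : UCPMap B C) (g : UCPMap A B) : UCPMap A C where
  toLin := f.toLin ∘ₗ g.toLin
  map_one := by
    rw [LinearMap.comp_apply, g.map_one, f.map_one]
  map_matPos := fun n M hM => f.map_matPos n (M.map g.toLin) (g.map_matPos n M hM)

/-- A complete order injection: an injective map that is a complete order isomorphism onto its
range, i.e. that reflects positivity of matrices of all sizes. -/
def IsEmbedding {A B : OperatorSystem.{u}} (f : UCPMap A B) : Prop :=
  Function.Injective f ∧
    ∀ (n : ℕ) (M : Matrix (Fin n) (Fin n) A), B.MatPos (M.map f.toLin) → A.MatPos M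

/-- A complete order isomorphism: a bijection that is completely positive together with its
inverse. -/
def IsIso {A B : OperatorSystem.{u}} (f : UCPMap A B) : Prop :=
  Function.Bijective f ∧
    ∀ (n : ℕ) (M : Matrix (Fin n) (Fin n) A), B.MatPos (M.map f.toLin) → A.MatPos M

/-- A unital star homomorphism of C*-algebras, as a unital completely positive map. -/
def ofStarAlgHom {B C : Type u} [CStarAlgebra B] [CStarAlgebra C] (φ : B →⋆ₐ[ℂ] C) :
    UCPMap (OperatorSystem.ofCStarAlgebra B) (OperatorSystem.ofCStarAlgebra C) where
  toLin := LinearMap.codRestrict (⊤ : Submodule ℂ C)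
    ((φ : B →ₗ[ℂ] C) ∘ₗ (⊤ : Submodule ℂ B).subtype) (fun _ => Submodule.mem_top)
  map_one := Subtype.ext (_root_.map_one φ)
  map_matPos := by
    rintro n M ⟨N, hN⟩
    refine ⟨(show Matrix (Fin n) (Fin n) B from N).map φ, ?_⟩
    ext i j
    have h := congrArg φ (congrFun (congrFun hN i) j)
    refine h.trans ?_
    rw [Matrix.mul_apply, Matrix.mul_apply]
    refine (map_sum φ _ _).trans (Finset.sum_congr rfl fun k _ => ?_)
    refine (map_mul φ _ _).trans ?_
    exact congrArg (fun t => t * φ (N k j)) (map_star φ (N k i))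

theorem ofStarAlgHom_isIso {B C : Type u} [CStarAlgebra B] [CStarAlgebra C] (φ : B →⋆ₐ[ℂ] C)
    (ψ : C →⋆ₐ[ℂ] B) (h1 : ∀ b, ψ (φ b) = b) (h2 : ∀ c, φ (ψ c) = c) :
    (ofStarAlgHom φ).IsIso := by
  have h3 : ∀ b, ofStarAlgHom ψ (ofStarAlgHom φ b) = b := fun b => Subtype.ext (h1 b.1)
  have h4 : ∀ c, ofStarAlgHom φ (ofStarAlgHom ψ c) = c := fun c => Subtype.ext (h2 c.1)
  refine ⟨⟨Function.LeftInverse.injective h3, Function.RightInverse.surjective h4⟩, ?_⟩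
  intro n M hM
  have h5 := (ofStarAlgHom ψ).map_matPos n _ hM
  have h6 : (M.map (ofStarAlgHom φ).toLin).map (ofStarAlgHom ψ).toLin = M := by
    ext i j
    exact congrArg Subtype.val (h3 (M i j))
  rwa [h6] at h5

end UCPMap

/-- A groupoid dynamical system over the groupoid `G`. The objects of `G` are the units; an arrow
`g : x ⟶ y` has source `d(g) = x` and range `r(g) = y`, and the groupoid product `g h` is the
composite `h ≫ g`. -/
structure GroupoidDynamicalSystem (G : Type u) [Groupoid.{u} G] where
  /-- The operator system over a unit. -/
  fiber : G → OperatorSystem.{u}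
  /-- The action of an arrow. -/
  act : ∀ {x y : G}, (x ⟶ y) → UCPMap (fiber x) (fiber y)
  act_isIso : ∀ {x y : G} (g : x ⟶ y), (act g).IsIso
  act_mul : ∀ {x y z : G} (h : x ⟶ y) (g : y ⟶ z) (a : fiber x),
    act g (act h a) = act (h ≫ g) a

namespace GroupoidDynamicalSystem

variable {G : Type u} [Groupoid.{u} G]

/-- A `G`-morphism: an equivariant family of unital completely positive maps. -/
@[ext]
structure Morphism (A B : GroupoidDynamicalSystem G) where
  /-- The map over a unit. -/
  app : ∀ x : G, UCPMap (A.fiber x) (B.fiber x)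
  equivariant : ∀ {x y : G} (g : x ⟶ y) (a : A.fiber x),
    B.act g (app x a) = app y (A.act g a)

namespace Morphism

/-- The composition `Ψ ∘ Φ` of `G`-morphisms. -/
def comp {A B C : GroupoidDynamicalSystem G} (Ψ : Morphism B C) (Φ : Morphism A B) :
    Morphism A C where
  app := fun x => (Ψ.app x).comp (Φ.app x)
  equivariant := by
    intro x y g a
    change C.act g (Ψ.app x (Φ.app x a)) = Ψ.app y (Φ.app y (A.act g a))
    rw [Ψ.equivariant, Φ.equivariant]

/-- A `G`-injection (`G`-embedding): every component is a complete order injection. A pair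
`(W, Θ)` with `Θ : A ⟶ W` such a morphism is a `G`-extension of `A`. -/
def IsEmbedding {A B : GroupoidDynamicalSystem G} (Φ : Morphism A B) : Prop :=
  ∀ x, (Φ.app x).IsEmbedding

/-- A `G`-isomorphism: every component is a complete order isomorphism. -/
def IsIso {A B : GroupoidDynamicalSystem G} (Φ : Morphism A B) : Prop :=
  ∀ x, (Φ.app x).IsIso

/-- `G`-essentiality of `(W, Θ)`. -/
def IsEssential {A W : GroupoidDynamicalSystem G} (Θ : Morphism A W) : Prop :=
  ∀ (C : GroupoidDynamicalSystem G) (Φ : Morphism W C), (Φ.comp Θ).IsEmbedding → Φ.IsEmbedding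

/-- `G`-rigidity of `(W, Θ)`. -/
def IsRigid {A W : GroupoidDynamicalSystem G} (Θ : Morphism A W) : Prop :=
  ∀ Φ : Morphism W W, Φ.comp Θ = Θ → ∀ (x : G) (w : W.fiber x), Φ.app x w = w

end Morphism

/-- `G`-injectivity of a groupoid dynamical system. -/
def IsInjective (W : GroupoidDynamicalSystem G) : Prop :=
  ∀ (A B : GroupoidDynamicalSystem G) (Φ : Morphism A B), Φ.IsEmbedding →
    ∀ Ψ : Morphism A W, ∃ Θ : Morphism B W, Θ.comp Φ = Ψ

/-- A dynamical subsystem of `B`: an invariant family of operator subsystems of the fibers. -/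
structure Subsystem (B : GroupoidDynamicalSystem G) where
  /-- The operator subsystem over a unit. -/
  carrier : ∀ x : G, Submodule ℂ (B.fiber x).Ambient
  le : ∀ x, carrier x ≤ (B.fiber x).carrier
  isClosed : ∀ x, IsClosed (carrier x : Set (B.fiber x).Ambient)
  star_mem : ∀ x, ∀ b ∈ carrier x, star b ∈ carrier x
  one_mem : ∀ x, (1 : (B.fiber x).Ambient) ∈ carrier x
  act_mem : ∀ {x y : G} (g : x ⟶ y) (b : B.fiber x),
    (b : (B.fiber x).Ambient) ∈ carrier x → (B.act g b : (B.fiber y).Ambient) ∈ carrier y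

namespace Subsystem

variable {B : GroupoidDynamicalSystem G} (S : Subsystem B)

/-- The operator system over a unit of a dynamical subsystem. -/
def fiber (x : G) : OperatorSystem.{u} where
  Ambient := (B.fiber x).Ambient
  carrier := S.carrier x
  isClosed := S.isClosed x
  star_mem := S.star_mem x
  one_mem := S.one_mem x

/-- The inclusion of the fiber of a subsystem. -/
def incl (x : G) : S.fiber x →ₗ[ℂ] B.fiber x := Submodule.inclusion (S.le x)

/-- The restriction of the action to a subsystem. -/
def act {x y : G} (g : x ⟶ y) : UCPMap (S.fiber x) (S.fiber y) where
  toLin := LinearMap.codRestrict (S.carrier y)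
    ((B.fiber y).carrier.subtype ∘ₗ (B.act g).toLin ∘ₗ S.incl x)
    (fun b => S.act_mem g (S.incl x b) b.2)
  map_one := by
    have h1 := congrArg Subtype.val (B.act g).map_one
    exact Subtype.ext h1
  map_matPos := fun n M hM => (B.act g).map_matPos n (M.map (S.incl x)) hM

/-- A dynamical subsystem, as a groupoid dynamical system of its own. -/
def toSystem : GroupoidDynamicalSystem G where
  fiber := S.fiber
  act := S.act
  act_isIso := by
    have hmul : ∀ {x y z : G} (h : x ⟶ y) (g : y ⟶ z) (a : S.fiber x),
        S.act g (S.act h a) = S.act (h ≫ g) a := by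
      intro x y z h g a
      have h1 := congrArg Subtype.val (B.act_mul h g (S.incl _ a))
      exact Subtype.ext h1
    have hinj : ∀ {x y : G} (g : x ⟶ y), Function.Injective (S.act g) := by
      intro x y g a b hab
      have h0 := congrArg Subtype.val hab
      have h1 : B.act g (S.incl x a) = B.act g (S.incl x b) := Subtype.ext h0
      exact Submodule.inclusion_injective (S.le x) ((B.act_isIso g).1.1 h1)
    intro x y g
    refine ⟨⟨hinj g, fun b => ⟨S.act (Groupoid.inv g) b, ?_⟩⟩, fun n M hM => ?_⟩
    · apply hinj (𝟙 y)
      rw [hmul, hmul, ← Category.assoc, Groupoid.inv_comp, Category.id_comp]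
    · exact (B.act_isIso g).2 n (M.map (S.incl x)) hM
  act_mul := by
    intro x y z h g a
    have h1 := congrArg Subtype.val (B.act_mul h g (S.incl _ a))
    exact Subtype.ext h1

/-- The dynamical subsystem `S` is the range `{θ_x(B_x)}` of the `G`-morphism `Θ = {θ_x}`. -/
def IsRange (Θ : Morphism B B) : Prop :=
  ∀ (x : G) (b : B.fiber x),
    (b : (B.fiber x).Ambient) ∈ S.carrier x ↔ ∃ b' : B.fiber x, Θ.app x b' = b

end Subsystem

/-- `(I, Υ)` is a `G`-injective envelope of `A`: it is a `G`-injective `G`-extension of `A`, and it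
is minimal as such, i.e. `I` is the only `G`-injective dynamical subsystem of `I` that contains
the image of `A`. -/
def IsInjectiveEnvelope {A I : GroupoidDynamicalSystem G} (Υ : Morphism A I) : Prop :=
  Υ.IsEmbedding ∧ I.IsInjective ∧
    ∀ S : Subsystem I, S.toSystem.IsInjective →
      (∀ (x : G) (a : A.fiber x), (Υ.app x a : (I.fiber x).Ambient) ∈ S.carrier x) →
      ∀ x, S.carrier x = (I.fiber x).carrier

/-- `Θ` is an `A`-projection on `W`, where `A` is regarded as a dynamical subsystem of `W` by means
of `J`: it is idempotent and restricts to the identity on the image of `A`. -/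
def IsProjection {A W : GroupoidDynamicalSystem G} (J : Morphism A W) (Θ : Morphism W W) : Prop :=
  Θ.comp Θ = Θ ∧ Θ.comp J = J

/-- `Θ` is minimal among the `A`-projections on `W` for the order in which `Φ ≼ Θ` means
`Θ ∘ Φ = Φ ∘ Θ = Φ`. -/
def IsMinimalProjection {A W : GroupoidDynamicalSystem G} (J : Morphism A W)
    (Θ : Morphism W W) : Prop :=
  IsProjection J Θ ∧
    ∀ Φ : Morphism W W, IsProjection J Φ → Θ.comp Φ = Φ → Φ.comp Θ = Φ → Φ = Θ

/-- The range fiber of a unit `x`: all arrows with range `x`. It carries the discrete topology, so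
that bounded continuous functions on it are just bounded functions. -/
structure RangeFiber (x : G) where
  /-- The source of the arrow. -/
  source : G
  /-- The arrow. -/
  hom : source ⟶ x

instance (x : G) : TopologicalSpace (RangeFiber x) := ⊥

instance (x : G) : DiscreteTopology (RangeFiber x) := ⟨rfl⟩

/-- Left multiplication `h ↦ g⁻¹ h`, from arrows with range `r(g)` to arrows with range `d(g)`. -/
def RangeFiber.invMul {x y : G} (g : x ⟶ y) (h : RangeFiber y) : RangeFiber x :=
  ⟨h.source, h.hom ≫ Groupoid.inv g⟩

section EllInfty

variable (H : Type u) [NormedAddCommGroup H] [InnerProductSpace ℂ H] [CompleteSpace H]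

/-- The C*-algebra `ℓ^∞(G^x, B(H))` of all bounded `B(H)`-valued functions on the range fiber of
`x`, with pointwise operations and the supremum norm. -/
abbrev EllInftyAlgebra (x : G) : Type u := RangeFiber x →ᵇ (H →L[ℂ] H)

/-- The translation `ℓ_g(f)(h) = f(g⁻¹ h)`. -/
def translate {x y : G} (g : x ⟶ y) : EllInftyAlgebra H x →⋆ₐ[ℂ] EllInftyAlgebra H y where
  toFun := fun f => f.compContinuous ⟨RangeFiber.invMul g, continuous_of_discreteTopology⟩
  map_one' := rfl
  map_mul' := fun _ _ => rfl
  map_zero' := rfl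
  map_add' := fun _ _ => rfl
  commutes' := fun _ => rfl
  map_star' := fun _ => rfl

theorem translate_translate {x y z : G} (h : x ⟶ y) (g : y ⟶ z) (f : EllInftyAlgebra H x) :
    translate H g (translate H h f) = translate H (h ≫ g) f := by
  ext1 k
  change f _ = f _
  congr 1
  simp [RangeFiber.invMul]

theorem translate_id {x : G} (f : EllInftyAlgebra H x) : translate H (𝟙 x) f = f := by
  ext1 k
  change f _ = f _
  congr 1
  simp [RangeFiber.invMul]

variable (G)

/-- The groupoid dynamical system `{ℓ^∞(G^x, B(H))}` with the translation action. -/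
def ellInfty : GroupoidDynamicalSystem G where
  fiber := fun x => OperatorSystem.ofCStarAlgebra (EllInftyAlgebra H x)
  act := fun g => UCPMap.ofStarAlgHom (translate H g)
  act_isIso := by
    intro x y g
    apply UCPMap.ofStarAlgHom_isIso _ (translate H (Groupoid.inv g))
    · intro f
      rw [translate_translate, Groupoid.comp_inv, translate_id]
    · intro f
      rw [translate_translate, Groupoid.inv_comp, translate_id]
  act_mul := fun h g f => Subtype.ext (translate_translate H h g f.1)

variable {G}

/-- The value at `k` of an element of a fiber of the system `{ℓ^∞(G^x, B(H))}`. -/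
def ellInftyEval {x : G} (f : (ellInfty G H).fiber x) (k : RangeFiber x) : H →L[ℂ] H :=
  (show EllInftyAlgebra H x from f.1) k

end EllInfty

end GroupoidDynamicalSystem

end

open GroupoidDynamicalSystem

/-!
The theorem follows from a good supply of `G`-injective systems and from Hamana's argument with
minimal seminorms.

*Injective systems.* `B(H)` is injective among operator systems (`exists_ucpMap_extension`): a map
into `B(H)` is the same thing as a linear functional on finitely supported matrices, indexed by a
linear basis of `H`, that is positive on positive matrices, and such functionals extend by the
theorem of M. Riesz. A `G`-morphism into the system `W` of bounded `B(H)`-valued functions on the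
range fibers is determined by its values at the units, and these values are arbitrary maps of the
fibers into `B(H)` (`FreeModel.exists_coinduced`). So `W` is `G`-injective
(`FreeModel.isInjective`), and complete order injections `A_u → B(H)` give a `G`-embedding `J` of
`A` into `W`. They exist, with a common `H`, for all nonzero fibers, by the Gelfand–Naimark theorem
(`exists_common_embedding`). A zero fiber has no unital map into `B(H)` unless `H` is zero; the
construction then leaves out the arrows that start at such a unit.

*Minimal seminorms.* Every ultrafilter of endomorphisms of `W` has a limit
(`FreeModel.hasUltralimits`). By Zorn's lemma there is an endomorphism `Φ` that fixes `J(A)` and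
whose seminorm `w ↦ ‖Φ w‖` is minimal. A limit of the averages of the powers of `Φ` kills all
`w - Φ w`, and by minimality so does `Φ`, that is, `Φ` is idempotent
(`IsMinimalSeminorm.comp_self`). The same applies to `Φ Ψ Φ` for any endomorphism `Ψ` that fixes
`J(A)`, which gives `Φ Ψ Φ = Φ`. Hence the range of `Φ` is a rigid injective extension of `A`
(`IsMinimalSeminorm.exists_range`). The endomorphisms with minimal seminorm are exactly the minimal
`A`-projections.

*Envelopes.* A rigid injective extension is essential and minimal, and it is a retract of any other
injective extension of `A`. If the latter is minimal or essential, the retraction is an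
isomorphism, so that the latter is rigid as well. This proves the uniqueness of envelopes and the
equivalence of the three properties.
-/

/-! ### Positive matrices over a C*-algebra -/

section Gram

variable {B : Type*} [CStarAlgebra B] {n m : Type*} [Fintype n] [Fintype m]

/-- A matrix over a C*-algebra is a Gram matrix if it is of the form `N* N` for a square matrix
`N`, that is, if it is positive in the C*-algebra of matrices. -/
def IsGram (M : Matrix n n B) : Prop := ∃ N : Matrix n n B, M = N.conjTranspose * N

section Order

variable [PartialOrder B] [StarOrderedRing B]

theorem isGram_iff_nonneg [DecidableEq n] {M : Matrix n n B} :
    IsGram M ↔ 0 ≤ CStarMatrix.ofMatrix M := by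
  -- The adjoint and product of `CStarMatrix` are by definition those of `Matrix`.
  have key : ∀ {C : Type _} [CStarAlgebra C] [PartialOrder C] [StarOrderedRing C] (a : C),
      (∃ b, a = star b * b) ↔ 0 ≤ a := fun a =>
    CStarAlgebra.nonneg_iff_eq_star_mul_self.symm
  exact key (CStarMatrix.ofMatrix M)

end Order

theorem IsGram.add {M N : Matrix n n B} (hM : IsGram M) (hN : IsGram N) : IsGram (M + N) := by
  classical
  let _ := CStarAlgebra.spectralOrder B
  let _ := CStarAlgebra.spectralOrderedRing B
  rw [isGram_iff_nonneg] at *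
  exact add_nonneg hM hN

theorem isGram_zero : IsGram (0 : Matrix n n B) := ⟨0, by simp⟩

theorem IsGram.sum {ι : Type*} (s : Finset ι) {M : ι → Matrix n n B} (h : ∀ i ∈ s, IsGram (M i)) :
    IsGram (∑ i ∈ s, M i) :=
  Finset.sum_induction M IsGram (fun _ _ => IsGram.add) isGram_zero h

theorem IsGram.isHermitian {M : Matrix n n B} (hM : IsGram M) : M.conjTranspose = M := by
  obtain ⟨N, rfl⟩ := hM
  simp

/-- The row decomposition of `P* P` reduces the rectangular case to the square one. -/
theorem isGram_conjTranspose_mul_self (P : Matrix m n B) : IsGram (P.conjTranspose * P) := by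
  classical
  rcases isEmpty_or_nonempty n with hn | ⟨⟨i₀⟩⟩
  · exact ⟨0, by ext i; exact hn.elim i⟩
  · have key : P.conjTranspose * P
        = ∑ k, (Matrix.of fun i j => if i = i₀ then P k j else 0).conjTranspose
            * (Matrix.of fun i j => if i = i₀ then P k j else 0) := by
      ext i j
      simp [Matrix.mul_apply, Matrix.sum_apply, apply_ite star]
    rw [key]
    exact IsGram.sum _ fun k _ => ⟨_, rfl⟩

theorem IsGram.conj {M : Matrix n n B} (hM : IsGram M) (V : Matrix n m B) :
    IsGram (V.conjTranspose * M * V) := by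
  obtain ⟨N, rfl⟩ := hM
  have h := isGram_conjTranspose_mul_self (N * V)
  rwa [Matrix.conjTranspose_mul, Matrix.mul_assoc, ← Matrix.mul_assoc _ N V,
    ← Matrix.mul_assoc] at h

theorem IsGram.smul {M : Matrix n n B} (hM : IsGram M) {r : ℝ} (hr : 0 ≤ r) :
    IsGram ((r : ℂ) • M) := by
  obtain ⟨N, rfl⟩ := hM
  refine ⟨((Real.sqrt r : ℝ) : ℂ) • N, ?_⟩
  rw [Matrix.conjTranspose_smul, Matrix.smul_mul, Matrix.mul_smul, smul_smul]
  congr 1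
  rw [Complex.star_def, Complex.conj_ofReal, ← Complex.ofReal_mul, Real.mul_self_sqrt hr]

/-- The unit matrix is an order unit for the self-adjoint matrices. -/
theorem exists_isGram_smul_one_add [DecidableEq n] {M : Matrix n n B} (hM : M.conjTranspose = M) :
    ∃ c : ℝ, 0 ≤ c ∧ IsGram ((c : ℂ) • (1 : Matrix n n B) + M) := by
  let _ := CStarAlgebra.spectralOrder B
  let _ := CStarAlgebra.spectralOrderedRing B
  refine ⟨‖CStarMatrix.ofMatrix M‖, norm_nonneg _, isGram_iff_nonneg.2 ?_⟩
  have hsa : IsSelfAdjoint (CStarMatrix.ofMatrix M) := hM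
  have h := hsa.neg_algebraMap_norm_le_self
  rw [neg_le_iff_add_nonneg] at h
  rw [add_comm, ← CStarMatrix.of_add_of]
  convert h using 2
  rw [Algebra.algebraMap_eq_smul_one, ← Complex.coe_smul]
  rfl

theorem isGram_one_iff_norm_le {a : B} :
    IsGram !![(1 : B), a; star a, (1 : B)] ↔ ‖a‖ ≤ 1 := by
  let _ := CStarAlgebra.spectralOrder B
  let _ := CStarAlgebra.spectralOrderedRing B
  have hnorm : star a * a ≤ 1 ↔ ‖a‖ ≤ 1 := by
    rw [← CStarAlgebra.norm_le_one_iff_of_nonneg (star a * a) (star_mul_self_nonneg a),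
      CStarRing.norm_star_mul_self]
    constructor
    · intro h
      nlinarith [norm_nonneg a]
    · intro h
      nlinarith [norm_nonneg a]
  rw [← hnorm]
  constructor
  · rintro ⟨N, hN⟩
    have h00 := congrFun (congrFun hN 0) 0
    have h01 := congrFun (congrFun hN 0) 1
    have h10 := congrFun (congrFun hN 1) 0
    have h11 := congrFun (congrFun hN 1) 1
    simp only [Matrix.mul_apply, Matrix.conjTranspose_apply, Fin.sum_univ_two, Matrix.of_apply,
      Matrix.cons_val', Matrix.cons_val_zero, Matrix.cons_val_one, Matrix.cons_val_fin_one]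
      at h00 h01 h10 h11
    -- The columns `p, q` of `N` satisfy `p* p = 1 = q* q` and `p* q = a`, so that `1 - a* a` is
    -- the inner square of `p a - q`.
    have hsum : 1 - star a * a = star (N 0 0 * a - N 0 1) * (N 0 0 * a - N 0 1)
        + star (N 1 0 * a - N 1 1) * (N 1 0 * a - N 1 1) := by
      have e : star (N 0 0 * a - N 0 1) * (N 0 0 * a - N 0 1)
          + star (N 1 0 * a - N 1 1) * (N 1 0 * a - N 1 1)
          = star a * (star (N 0 0) * N 0 0 + star (N 1 0) * N 1 0) * a
            - star a * (star (N 0 0) * N 0 1 + star (N 1 0) * N 1 1)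
            - (star (N 0 1) * N 0 0 + star (N 1 1) * N 1 0) * a
            + (star (N 0 1) * N 0 1 + star (N 1 1) * N 1 1) := by
        simp only [star_sub, star_mul]
        noncomm_ring
      rw [e, ← h00, ← h01, ← h10, ← h11]
      noncomm_ring
    rw [← sub_nonneg, hsum]
    exact add_nonneg (star_mul_self_nonneg _) (star_mul_self_nonneg _)
  · intro h
    obtain ⟨s, hs⟩ := CStarAlgebra.nonneg_iff_eq_star_mul_self.1 (sub_nonneg.2 h)
    refine ⟨!![1, a; 0, s], ?_⟩
    ext i j
    fin_cases i <;> fin_cases j <;> simp [Matrix.mul_apply, Fin.sum_univ_two, ← hs]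

/-- Positivity of the `2 × 2` matrix with rows `c, a` and `a*, c` says that `a` has norm at most
`c`. -/
theorem isGram_iff_norm_le {a : B} {c : ℝ} (hc : 0 ≤ c) :
    IsGram !![(c : ℂ) • (1 : B), a; star a, (c : ℂ) • (1 : B)] ↔ ‖a‖ ≤ c := by
  have pos : ∀ c : ℝ, 0 < c →
      (IsGram !![(c : ℂ) • (1 : B), a; star a, (c : ℂ) • (1 : B)] ↔ ‖a‖ ≤ c) := by
    intro c hc
    have hc' : (c : ℂ) ≠ 0 := Complex.ofReal_ne_zero.2 hc.ne'
    have e1 : ((c⁻¹ : ℝ) : ℂ) • !![(c : ℂ) • (1 : B), a; star a, (c : ℂ) • (1 : B)]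
        = !![1, ((c⁻¹ : ℝ) : ℂ) • a; star (((c⁻¹ : ℝ) : ℂ) • a), 1] := by
      ext i j
      fin_cases i <;> fin_cases j <;> simp [-Complex.coe_smul, smul_smul, hc', star_smul]
    have e2 : (c : ℂ) • !![1, ((c⁻¹ : ℝ) : ℂ) • a; star (((c⁻¹ : ℝ) : ℂ) • a), 1]
        = !![(c : ℂ) • (1 : B), a; star a, (c : ℂ) • (1 : B)] := by
      ext i j
      fin_cases i <;> fin_cases j <;> simp [-Complex.coe_smul, smul_smul, hc', star_smul]
    have h1 : ‖((c⁻¹ : ℝ) : ℂ) • a‖ ≤ 1 ↔ ‖a‖ ≤ c := by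
      rw [norm_smul, Complex.norm_real, Real.norm_of_nonneg (inv_nonneg.2 hc.le),
        inv_mul_le_iff₀ hc, mul_one]
    rw [← h1, ← isGram_one_iff_norm_le]
    constructor
    · intro h
      rw [← e1]
      exact h.smul (inv_nonneg.2 hc.le)
    · intro h
      rw [← e2]
      exact h.smul hc.le
  rcases hc.eq_or_lt with rfl | hc
  · constructor
    · intro h
      refine le_of_forall_pos_le_add fun ε hε => ?_
      rw [zero_add, ← pos ε hε]
      have h1 : IsGram (1 : Matrix (Fin 2) (Fin 2) B) := ⟨1, by simp⟩
      convert h.add (h1.smul hε.le) using 1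
      ext i j
      fin_cases i <;> fin_cases j <;> simp
    · intro h
      have h0 : a = 0 := norm_le_zero_iff.1 h
      subst h0
      convert (isGram_zero : IsGram (0 : Matrix (Fin 2) (Fin 2) B)) using 1
      ext i j
      fin_cases i <;> fin_cases j <;> simp
  · exact pos c hc

end Gram

/-! ### Unital completely positive maps -/

namespace OperatorSystem

variable {A : OperatorSystem.{u}}

instance (A : OperatorSystem.{u}) : StarAddMonoid A where
  star := fun a => ⟨star a.1, A.star_mem a.1 a.2⟩
  star_involutive := fun a => Subtype.ext (star_star a.1)
  star_add := fun a b => Subtype.ext (star_add a.1 b.1)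

instance (A : OperatorSystem.{u}) : StarModule ℂ A :=
  ⟨fun c a => Subtype.ext (star_smul c a.1)⟩

theorem coe_star (a : A) : ((star a : A) : A.Ambient) = star (a : A.Ambient) := rfl

theorem matPos_iff_isGram {n : ℕ} {M : Matrix (Fin n) (Fin n) A} :
    A.MatPos M ↔ IsGram (M.map fun x : A => (x : A.Ambient)) := Iff.rfl

theorem MatPos.add {n : ℕ} {M N : Matrix (Fin n) (Fin n) A} (hM : A.MatPos M) (hN : A.MatPos N) :
    A.MatPos (M + N) :=
  IsGram.add (B := A.Ambient) hM hN

theorem matPos_zero {n : ℕ} : A.MatPos (0 : Matrix (Fin n) (Fin n) A) :=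
  isGram_zero (B := A.Ambient)

theorem MatPos.smul {n : ℕ} {M : Matrix (Fin n) (Fin n) A} (hM : A.MatPos M) {r : ℝ}
    (hr : 0 ≤ r) : A.MatPos ((r : ℂ) • M) :=
  IsGram.smul (B := A.Ambient) hM hr

theorem MatPos.sum {n : ℕ} {ι : Type*} (s : Finset ι) {M : ι → Matrix (Fin n) (Fin n) A}
    (h : ∀ i ∈ s, A.MatPos (M i)) : A.MatPos (∑ i ∈ s, M i) :=
  Finset.sum_induction M A.MatPos (fun _ _ => MatPos.add) matPos_zero h

theorem matPos_of_subsingleton [Subsingleton A] {n : ℕ} (M : Matrix (Fin n) (Fin n) A) :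
    A.MatPos M := by
  rw [Subsingleton.elim M 0]
  exact matPos_zero

/-- Norms in an operator system are determined by its matrix order. -/
theorem matPos_iff_norm_le {a : A} {c : ℝ} (hc : 0 ≤ c) :
    A.MatPos !![(c : ℂ) • (1 : A), a; star a, (c : ℂ) • (1 : A)] ↔ ‖a‖ ≤ c := by
  rw [matPos_iff_isGram]
  refine Iff.trans ?_ (isGram_iff_norm_le (a := a.1) hc)
  refine iff_of_eq (congrArg IsGram ?_)
  ext i j
  fin_cases i <;> fin_cases j <;> rfl

end OperatorSystem

namespace UCPMap

open OperatorSystem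

variable {A B C : OperatorSystem.{u}}

theorem ext {f g : UCPMap A B} (h : ∀ a, f a = g a) : f = g := by
  have h1 : f.toLin = g.toLin := LinearMap.ext h
  cases f
  cases g
  congr

theorem comp_apply (f : UCPMap B C) (g : UCPMap A B) (a : A) : f.comp g a = f (g a) := rfl

theorem map_fin_two (f : UCPMap A B) (a b : A) (c : ℂ) :
    (!![c • (1 : A), a; b, c • (1 : A)]).map f.toLin
      = !![c • (1 : B), f a; f b, c • (1 : B)] := by
  ext i j
  fin_cases i <;> fin_cases j <;> simp [f.map_one]

theorem map_star (f : UCPMap A B) (a : A) : f (star a) = star (f a) := by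
  have h := f.map_matPos 2 _ ((matPos_iff_norm_le (norm_nonneg a)).2 le_rfl)
  rw [map_fin_two] at h
  exact Subtype.ext (congrFun (congrFun (IsGram.isHermitian (B := B.Ambient) h) 1) 0).symm

theorem norm_map_le (f : UCPMap A B) (a : A) : ‖f a‖ ≤ ‖a‖ := by
  have h := f.map_matPos 2 _ ((matPos_iff_norm_le (norm_nonneg a)).2 le_rfl)
  rw [map_fin_two, map_star] at h
  exact (matPos_iff_norm_le (norm_nonneg a)).1 h

theorem continuous (f : UCPMap A B) : Continuous f :=
  (f.toLin.mkContinuous 1 fun a => by simpa using f.norm_map_le a).continuous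

/-- A unital completely positive map that reflects positivity of matrices is isometric. -/
theorem isEmbedding_of_reflects {f : UCPMap A B}
    (h : ∀ (n : ℕ) (M : Matrix (Fin n) (Fin n) A), B.MatPos (M.map f.toLin) → A.MatPos M) :
    f.IsEmbedding := by
  refine ⟨(injective_iff_map_eq_zero f.toLin).2 fun a ha => ?_, h⟩
  have h1 : ‖f a‖ ≤ 0 := by
    have : f a = 0 := ha
    rw [this, norm_zero]
  rw [← matPos_iff_norm_le le_rfl, ← map_star, ← map_fin_two] at h1
  exact norm_le_zero_iff.1 ((matPos_iff_norm_le le_rfl).1 (h 2 _ h1))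

/-- The identity map. -/
noncomputable def id (A : OperatorSystem.{u}) : UCPMap A A where
  toLin := LinearMap.id
  map_one := rfl
  map_matPos := fun _ _ hM => hM

/-- The average of the first `n + 1` terms of a sequence of unital completely positive maps. -/
noncomputable def average (n : ℕ) (f : ℕ → UCPMap A B) : UCPMap A B where
  toLin := (((n + 1 : ℝ)⁻¹ : ℝ) : ℂ) • ∑ k ∈ Finset.range (n + 1), (f k).toLin
  map_one := by
    have hn : ((n : ℂ) + 1) ≠ 0 := by exact_mod_cast n.succ_ne_zero
    rw [LinearMap.smul_apply, LinearMap.sum_apply, Finset.sum_congr rfl fun k _ => (f k).map_one,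
      Finset.sum_const, Finset.card_range, ← Nat.cast_smul_eq_nsmul ℂ, smul_smul]
    push_cast
    rw [inv_mul_cancel₀ hn, one_smul]
  map_matPos := by
    intro m M hM
    have h := (MatPos.sum (Finset.range (n + 1)) fun k _ => (f k).map_matPos m M hM).smul
      (r := (n + 1 : ℝ)⁻¹) (by positivity)
    convert h using 1
    ext i j
    simp [Matrix.sum_apply]

theorem average_apply (n : ℕ) (f : ℕ → UCPMap A B) (a : A) :
    average n f a = (((n + 1 : ℝ)⁻¹ : ℝ) : ℂ) • ∑ k ∈ Finset.range (n + 1), f k a := by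
  simp [average]

end UCPMap

namespace GroupoidDynamicalSystem

variable {G : Type u} [Groupoid.{u} G]

theorem act_id {A : GroupoidDynamicalSystem G} {x : G} (a : A.fiber x) : A.act (𝟙 x) a = a := by
  apply (A.act_isIso (𝟙 x)).1.1
  rw [A.act_mul, Category.id_comp]

namespace Morphism

variable {A B C D : GroupoidDynamicalSystem G}

theorem ext_apply {Φ Ψ : Morphism A B} (h : ∀ x a, Φ.app x a = Ψ.app x a) : Φ = Ψ :=
  Morphism.ext (funext fun x => UCPMap.ext (h x))

theorem congr_apply {Φ Ψ : Morphism A B} (h : Φ = Ψ) (x : G) (a : A.fiber x) :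
    Φ.app x a = Ψ.app x a := by rw [h]

theorem comp_apply (Ψ : Morphism B C) (Φ : Morphism A B) (x : G) (a : A.fiber x) :
    (Ψ.comp Φ).app x a = Ψ.app x (Φ.app x a) := rfl

theorem comp_assoc (Θ : Morphism C D) (Ψ : Morphism B C) (Φ : Morphism A B) :
    (Θ.comp Ψ).comp Φ = Θ.comp (Ψ.comp Φ) := rfl

/-- The identity morphism. -/
noncomputable def id (A : GroupoidDynamicalSystem G) : Morphism A A where
  app := fun x => UCPMap.id (A.fiber x)
  equivariant := fun _ _ => rfl

theorem id_comp (Φ : Morphism A B) : (Morphism.id B).comp Φ = Φ := rfl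

theorem isEmbedding_of_comp {Ψ : Morphism B C} {Φ : Morphism A B}
    (h : (Ψ.comp Φ).IsEmbedding) : Φ.IsEmbedding := fun x =>
  UCPMap.isEmbedding_of_reflects fun n M hM =>
    (h x).2 n M ((Ψ.app x).map_matPos n (M.map (Φ.app x).toLin) hM)

theorem isEmbedding_id (A : GroupoidDynamicalSystem G) : (Morphism.id A).IsEmbedding := fun _ =>
  ⟨fun _ _ h => h, fun _ _ h => h⟩

/-- The average of the first `n + 1` terms of a sequence of morphisms. -/
noncomputable def average (n : ℕ) (Φ : ℕ → Morphism A B) : Morphism A B where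
  app := fun x => UCPMap.average n fun k => (Φ k).app x
  equivariant := by
    intro x y g a
    have h : ∀ k, B.act g ((Φ k).app x a) = (Φ k).app y (A.act g a) :=
      fun k => (Φ k).equivariant g a
    rw [UCPMap.average_apply, UCPMap.average_apply, map_smul, map_sum]
    exact congrArg _ (Finset.sum_congr rfl fun k _ => h k)

theorem average_apply (n : ℕ) (Φ : ℕ → Morphism A B) (x : G) (a : A.fiber x) :
    (average n Φ).app x a
      = (((n + 1 : ℝ)⁻¹ : ℝ) : ℂ) • ∑ k ∈ Finset.range (n + 1), (Φ k).app x a :=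
  UCPMap.average_apply n _ a

end Morphism

end GroupoidDynamicalSystem

namespace GroupoidDynamicalSystem

variable {G : Type u} [Groupoid.{u} G]

/-! ### Ranges of idempotent morphisms -/

namespace Subsystem

variable {A B : GroupoidDynamicalSystem G}

/-- The range of an idempotent morphism, which is closed because it is the kernel of a continuous
map. -/
noncomputable def ofIdempotent (E : Morphism B B) (hE : E.comp E = E) : Subsystem B where
  carrier := fun x => (LinearMap.range (E.app x).toLin).map (B.fiber x).carrier.subtype
  le := fun x => Submodule.map_subtype_le _ _
  isClosed := by
    intro x
    have h1 : ((LinearMap.range (E.app x).toLin).map (B.fiber x).carrier.subtype :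
        Set (B.fiber x).Ambient) = Subtype.val '' {b : B.fiber x | E.app x b = b} := by
      rw [Submodule.map_coe]
      refine congrArg _ (Set.ext fun b => ⟨?_, fun h => ⟨b, h⟩⟩)
      rintro ⟨b', rfl⟩
      exact Morphism.congr_apply hE x b'
    rw [h1]
    exact (B.fiber x).isClosed.isClosedEmbedding_subtypeVal.isClosedMap _
      (isClosed_eq (E.app x).continuous continuous_id)
  star_mem := by
    rintro x _ ⟨_, ⟨b, rfl⟩, rfl⟩
    exact ⟨_, ⟨star b, rfl⟩, congrArg Subtype.val ((E.app x).map_star b)⟩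
  one_mem := fun x => ⟨_, ⟨1, rfl⟩, congrArg Subtype.val (E.app x).map_one⟩
  act_mem := by
    rintro x y g b ⟨_, ⟨b', rfl⟩, hb⟩
    have hb' : E.app x b' = b := Subtype.ext hb
    subst hb'
    exact ⟨_, ⟨B.act g b', rfl⟩, congrArg Subtype.val (E.equivariant g b').symm⟩

theorem mem_ofIdempotent {E : Morphism B B} {hE : E.comp E = E} {x : G} {b : B.fiber x} :
    (b : (B.fiber x).Ambient) ∈ (ofIdempotent E hE).carrier x ↔ ∃ b', E.app x b' = b := by
  constructor
  · rintro ⟨_, ⟨b', rfl⟩, hb⟩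
    exact ⟨b', Subtype.ext hb⟩
  · rintro ⟨b', rfl⟩
    exact ⟨_, ⟨b', rfl⟩, rfl⟩

theorem isRange_ofIdempotent (E : Morphism B B) (hE : E.comp E = E) :
    (ofIdempotent E hE).IsRange E := fun _ _ => mem_ofIdempotent

variable (S : Subsystem B)

/-- The inclusion of a dynamical subsystem, as a morphism. -/
noncomputable def inclusion : Morphism S.toSystem B where
  app := fun x =>
    { toLin := S.incl x
      map_one := rfl
      map_matPos := fun _ _ hM => hM }
  equivariant := fun _ _ => rfl

theorem isEmbedding_inclusion : S.inclusion.IsEmbedding := fun _ =>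
  UCPMap.isEmbedding_of_reflects fun _ _ hM => hM

/-- The corestriction of a morphism to a subsystem that contains its range. -/
noncomputable def codRestrict (Φ : Morphism A B)
    (h : ∀ x a, (Φ.app x a : (B.fiber x).Ambient) ∈ S.carrier x) : Morphism A S.toSystem where
  app := fun x =>
    { toLin := LinearMap.codRestrict (S.carrier x)
        ((B.fiber x).carrier.subtype ∘ₗ (Φ.app x).toLin) (h x)
      map_one := by
        have h1 := congrArg Subtype.val (Φ.app x).map_one
        exact Subtype.ext h1
      map_matPos := fun n M hM => (Φ.app x).map_matPos n M hM }
  equivariant := by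
    intro x y g a
    have h1 := congrArg Subtype.val (Φ.equivariant g a)
    exact Subtype.ext h1

theorem inclusion_comp_codRestrict (Φ : Morphism A B)
    (h : ∀ x a, (Φ.app x a : (B.fiber x).Ambient) ∈ S.carrier x) :
    S.inclusion.comp (S.codRestrict Φ h) = Φ := rfl

end Subsystem

/-! ### Injectivity, rigidity and envelopes -/

variable {A B R I W : GroupoidDynamicalSystem G}

/-- A retract of an injective system is injective. -/
theorem IsInjective.of_retract (hB : B.IsInjective) (i : Morphism R B) (r : Morphism B R)
    (h : r.comp i = Morphism.id R) : R.IsInjective := by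
  intro C D Φ hΦ Ψ
  obtain ⟨Θ, hΘ⟩ := hB C D Φ hΦ (i.comp Ψ)
  refine ⟨r.comp Θ, ?_⟩
  rw [Morphism.comp_assoc, hΘ, ← Morphism.comp_assoc, h, Morphism.id_comp]

/-- The corestriction of an idempotent morphism to its range splits the inclusion of the range. -/
theorem IsInjective.ofIdempotent (hB : B.IsInjective) (E : Morphism B B) (hE : E.comp E = E) :
    (Subsystem.ofIdempotent E hE).toSystem.IsInjective := by
  refine hB.of_retract (Subsystem.inclusion _)
    (Subsystem.codRestrict _ E fun x a => Subsystem.mem_ofIdempotent.2 ⟨a, rfl⟩) ?_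
  refine Morphism.ext_apply fun x a => ?_
  have h1 : E.app x (Subsystem.incl _ x a) = Subsystem.incl _ x a := by
    obtain ⟨b, hb⟩ := (Subsystem.mem_ofIdempotent (hE := hE) (b := Subsystem.incl _ x a)).1 a.2
    rw [← hb]
    exact Morphism.congr_apply hE x b
  have h2 := congrArg Subtype.val h1
  exact Subtype.ext h2

theorem Morphism.IsRigid.comp_eq_id {Υ : Morphism A I} (h : Υ.IsRigid) {Φ : Morphism I I}
    (hΦ : Φ.comp Υ = Υ) : Φ = Morphism.id I :=
  Morphism.ext_apply (h Φ hΦ)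

theorem isInjectiveEnvelope_of_isRigid {Υ : Morphism A I} (hΥ : Υ.IsEmbedding)
    (hI : I.IsInjective) (hr : Υ.IsRigid) : IsInjectiveEnvelope Υ := by
  refine ⟨hΥ, hI, fun S hS hAS x => le_antisymm (S.le x) ?_⟩
  obtain ⟨r, hr'⟩ := hS _ _ S.inclusion S.isEmbedding_inclusion (Morphism.id _)
  have h1 : (S.inclusion.comp r).comp Υ = Υ := by
    rw [← S.inclusion_comp_codRestrict Υ hAS, Morphism.comp_assoc, ← Morphism.comp_assoc r, hr',
      Morphism.id_comp]
  intro b hb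
  have h2 := hr _ h1 x ⟨b, hb⟩
  have h3 : (r.app x ⟨b, hb⟩).1 = b := congrArg Subtype.val h2
  rw [← h3]
  exact (r.app x ⟨b, hb⟩).2

theorem Morphism.IsRigid.isEssential {Υ : Morphism A I} (hI : I.IsInjective) (hr : Υ.IsRigid) :
    Υ.IsEssential := by
  intro C Φ hΦ
  obtain ⟨Ψ, hΨ⟩ := hI _ _ _ hΦ Υ
  rw [← Morphism.comp_assoc] at hΨ
  have h := hr.comp_eq_id hΨ
  exact Morphism.isEmbedding_of_comp (h ▸ Morphism.isEmbedding_id I)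

/-- Between a rigid injective extension and any injective extension there are morphisms in both
directions, and the rigid one is a retract of the other. -/
theorem exists_retraction {ρ : Morphism A R} {Υ : Morphism A I} (hρ : ρ.IsEmbedding)
    (hR : R.IsInjective) (hr : ρ.IsRigid) (hΥ : Υ.IsEmbedding) (hI : I.IsInjective) :
    ∃ (f : Morphism R I) (g : Morphism I R), f.comp ρ = Υ ∧ g.comp Υ = ρ ∧
      g.comp f = Morphism.id R := by
  obtain ⟨f, hf⟩ := hI _ _ ρ hρ Υ
  obtain ⟨g, hg⟩ := hR _ _ Υ hΥ ρ
  refine ⟨f, g, hf, hg, hr.comp_eq_id ?_⟩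
  rw [Morphism.comp_assoc, hf, hg]

theorem Morphism.IsRigid.of_inverse {ρ : Morphism A R} {Υ : Morphism A I} (hr : ρ.IsRigid)
    {f : Morphism R I} {g : Morphism I R} (hf : f.comp ρ = Υ) (hg : g.comp Υ = ρ)
    (hfg : f.comp g = Morphism.id I) : Υ.IsRigid := by
  intro Φ hΦ
  have h1 : g.comp (Φ.comp f) = Morphism.id R := by
    apply hr.comp_eq_id
    rw [Morphism.comp_assoc, Morphism.comp_assoc, hf, hΦ, hg]
  have h2 : Φ = Morphism.id I := by
    calc Φ = (f.comp g).comp (Φ.comp (f.comp g)) := by rw [hfg]; rfl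
      _ = f.comp ((g.comp (Φ.comp f)).comp g) := rfl
      _ = Morphism.id I := by rw [h1, Morphism.id_comp, hfg]
  intro x w
  rw [h2]
  rfl

/-- Two morphisms that are inverse to each other are isomorphisms. -/
theorem Morphism.isIso_of_inverse {f : Morphism R I} {g : Morphism I R}
    (hgf : g.comp f = Morphism.id R) (hfg : f.comp g = Morphism.id I) : f.IsIso := by
  have h1 : f.IsEmbedding :=
    Morphism.isEmbedding_of_comp (Ψ := g) (hgf ▸ Morphism.isEmbedding_id R)
  exact fun x => ⟨⟨(h1 x).1, fun b => ⟨g.app x b, Morphism.congr_apply hfg x b⟩⟩, (h1 x).2⟩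

/-- If `A` has a rigid injective extension, then every injective envelope of `A` is isomorphic to
it: the composite of the two comparison morphisms is an idempotent whose range is an injective
subsystem, so it is the identity by minimality. -/
theorem IsInjectiveEnvelope.comp_eq_id {Υ : Morphism A I} (hΥ : IsInjectiveEnvelope Υ)
    {ρ : Morphism A R} {f : Morphism R I} {g : Morphism I R} (hf : f.comp ρ = Υ)
    (hg : g.comp Υ = ρ) (hgf : g.comp f = Morphism.id R) : f.comp g = Morphism.id I := by
  have hE : (f.comp g).comp (f.comp g) = f.comp g := by
    change f.comp ((g.comp f).comp g) = _
    rw [hgf, Morphism.id_comp]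
  have hEΥ : (f.comp g).comp Υ = Υ := by rw [Morphism.comp_assoc, hg, hf]
  have h := hΥ.2.2 _ (hΥ.2.1.ofIdempotent _ hE) fun x a =>
    Subsystem.mem_ofIdempotent.2 ⟨Υ.app x a, Morphism.congr_apply hEΥ x a⟩
  refine Morphism.ext_apply fun x b => ?_
  obtain ⟨b', rfl⟩ := (Subsystem.mem_ofIdempotent (hE := hE) (b := b)).1
    ((h x).symm.le b.2)
  exact Morphism.congr_apply hE x b'

theorem IsInjectiveEnvelope.isRigid {Υ : Morphism A I} (hΥ : IsInjectiveEnvelope Υ)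
    {ρ : Morphism A R} (hρ : ρ.IsEmbedding) (hR : R.IsInjective) (hr : ρ.IsRigid) :
    Υ.IsRigid := by
  obtain ⟨f, g, hf, hg, hgf⟩ := exists_retraction hρ hR hr hΥ.1 hΥ.2.1
  exact hr.of_inverse hf hg (hΥ.comp_eq_id hf hg hgf)

theorem Morphism.IsEssential.isRigid {Υ : Morphism A I} (he : Υ.IsEssential)
    (hΥ : Υ.IsEmbedding) (hI : I.IsInjective)
    {ρ : Morphism A R} (hρ : ρ.IsEmbedding) (hR : R.IsInjective) (hr : ρ.IsRigid) :
    Υ.IsRigid := by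
  obtain ⟨f, g, hf, hg, hgf⟩ := exists_retraction hρ hR hr hΥ hI
  have hgi : g.IsEmbedding := he R g (hg.symm ▸ hρ)
  refine hr.of_inverse hf hg (Morphism.ext_apply fun x b => (hgi x).1 ?_)
  exact Morphism.congr_apply hgf x (g.app x b)

theorem IsInjectiveEnvelope.exists_isIso {Υ : Morphism A I} {Φ : Morphism A B}
    (hΥ : IsInjectiveEnvelope Υ) (hΦ : IsInjectiveEnvelope Φ) (hr : Υ.IsRigid) :
    ∃ Ψ : Morphism I B, Ψ.IsIso ∧ Ψ.comp Υ = Φ := by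
  obtain ⟨f, g, hf, hg, hgf⟩ := exists_retraction hΥ.1 hΥ.2.1 hr hΦ.1 hΦ.2.1
  exact ⟨f, Morphism.isIso_of_inverse hgf (hΦ.comp_eq_id hf hg hgf), hf⟩

/-! ### Minimal projections -/

/-- A weak form of compactness of the set of endomorphisms of `W`: every ultrafilter on it has a
limit that preserves the closed balls. It stands for compactness in the point-weak* topology, in
which the closed balls are closed. -/
def HasUltralimits (W : GroupoidDynamicalSystem G) : Prop :=
  ∀ U : Ultrafilter (Morphism W W), ∃ Ψ : Morphism W W,
    ∀ (x : G) (w v : W.fiber x) (c : ℝ), (∀ᶠ Φ in (U : Filter (Morphism W W)),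
      ‖Φ.app x w - v‖ ≤ c) → ‖Ψ.app x w - v‖ ≤ c

/-- The seminorms `w ↦ ‖Φ w‖` are pointwise at most the seminorms `w ↦ ‖Ψ w‖`. -/
def SeminormLE (Φ Ψ : Morphism W W) : Prop := ∀ x w, ‖Φ.app x w‖ ≤ ‖Ψ.app x w‖

/-- `Φ` fixes the image of `A`, and the seminorm `w ↦ ‖Φ w‖` is minimal among those of the
endomorphisms that fix the image of `A`. -/
def IsMinimalSeminorm (J : Morphism A W) (Φ : Morphism W W) : Prop :=
  Φ.comp J = J ∧ ∀ Ψ : Morphism W W, Ψ.comp J = J → SeminormLE Ψ Φ → SeminormLE Φ Ψ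

/-- Zorn's lemma: a chain of seminorms is bounded below by that of an ultralimit. -/
theorem HasUltralimits.exists_isMinimalSeminorm_le (hW : HasUltralimits W) (J : Morphism A W)
    (Θ : Morphism W W) (hΘ : Θ.comp J = J) :
    ∃ Φ, IsMinimalSeminorm J Φ ∧ SeminormLE Φ Θ := by
  let X := {Φ : Morphism W W // Φ.comp J = J ∧ SeminormLE Φ Θ}
  have trans : ∀ {Φ Ψ Ω : Morphism W W}, SeminormLE Φ Ψ → SeminormLE Ψ Ω → SeminormLE Φ Ω :=
    fun h1 h2 x w => (h1 x w).trans (h2 x w)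
  suffices hchain : ∀ c : Set X, IsChain (fun a b : X => SeminormLE b.1 a.1) c →
      ∃ b : X, ∀ a ∈ c, SeminormLE b.1 a.1 by
    obtain ⟨m, hm⟩ := exists_maximal_of_chains_bounded hchain fun h1 h2 => trans h2 h1
    exact ⟨m.1, ⟨m.2.1, fun Ψ hΨ h => hm ⟨Ψ, hΨ, trans h m.2.2⟩ h⟩, m.2.2⟩
  intro c hc
  rcases c.eq_empty_or_nonempty with rfl | hne
  · exact ⟨⟨Θ, hΘ, fun _ _ => le_rfl⟩, fun a ha => ha.elim⟩
  -- The tails of the chain generate a proper filter.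
  let T : c → Set (Morphism W W) := fun a => {Φ | Φ.comp J = J ∧ SeminormLE Φ a.1.1}
  have hdir : Directed (· ≥ ·) fun a => Filter.principal (T a) := by
    intro a b
    have mono : ∀ {a b : c}, SeminormLE b.1.1 a.1.1 →
        Filter.principal (T b) ≤ Filter.principal (T a) := fun h =>
      Filter.principal_mono.2 fun Φ hΦ => ⟨hΦ.1, trans hΦ.2 h⟩
    by_cases hab : a.1 = b.1
    · exact ⟨b, mono (by rw [hab]; exact fun _ _ => le_rfl), le_rfl⟩
    · rcases hc a.2 b.2 hab with h | h
      · exact ⟨b, mono h, le_rfl⟩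
      · exact ⟨a, le_rfl, mono h⟩
  have : Nonempty c := hne.to_subtype
  have hF : (⨅ a, Filter.principal (T a)).NeBot :=
    Filter.iInf_neBot_of_directed' hdir fun a =>
      Filter.principal_neBot_iff.2 ⟨a.1.1, a.1.2.1, fun _ _ => le_rfl⟩
  obtain ⟨Ψ, hΨ⟩ := hW (Ultrafilter.of (⨅ a, Filter.principal (T a)))
  have hev : ∀ a, ∀ᶠ Φ in (Ultrafilter.of (⨅ a, Filter.principal (T a)) :
      Filter (Morphism W W)), Φ ∈ T a := fun a =>
    Ultrafilter.of_le _ (Filter.mem_iInf_of_mem a (Filter.mem_principal_self _))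
  have hle : ∀ a : c, SeminormLE Ψ a.1.1 := by
    intro a x w
    have h := hΨ x w 0 ‖a.1.1.app x w‖
      ((hev a).mono fun Φ hΦ => by rw [sub_zero]; exact hΦ.2 x w)
    rwa [sub_zero] at h
  have hJ : Ψ.comp J = J := by
    refine Morphism.ext_apply fun x a => ?_
    have h := hΨ x (J.app x a) (J.app x a) 0 ((hev (Classical.arbitrary c)).mono fun Φ hΦ => by
      have h1 : Φ.app x (J.app x a) = J.app x a := Morphism.congr_apply hΦ.1 x a
      rw [h1, sub_self, norm_zero])
    exact sub_eq_zero.1 (norm_le_zero_iff.1 h)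
  obtain ⟨a, ha⟩ := hne
  exact ⟨⟨Ψ, hJ, trans (hle ⟨a, ha⟩) a.2.2⟩, fun b hb => hle ⟨b, hb⟩⟩

/-- The iterates of an endomorphism. -/
noncomputable def Morphism.iterate (Φ : Morphism W W) : ℕ → Morphism W W
  | 0 => Morphism.id W
  | k + 1 => Φ.comp (iterate Φ k)

theorem Morphism.iterate_succ_apply (Φ : Morphism W W) (k : ℕ) (x : G) (w : W.fiber x) :
    (Φ.iterate (k + 1)).app x w = (Φ.iterate k).app x (Φ.app x w) := by
  induction k with
  | zero => rfl
  | succ k ih => exact congrArg (Φ.app x) ih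

theorem Morphism.iterate_apply_of_eq (Φ : Morphism W W) {x : G} {w : W.fiber x}
    (h : Φ.app x w = w) (k : ℕ) : (Φ.iterate k).app x w = w := by
  induction k with
  | zero => rfl
  | succ k ih => exact (congrArg (Φ.app x) ih).trans h

/-- The averages of the powers of `Φ` converge along an ultrafilter to an endomorphism that
vanishes at all `w - Φ w`; by minimality of the seminorm so does `Φ`. -/
theorem IsMinimalSeminorm.comp_self (hW : HasUltralimits W) {J : Morphism A W}
    {Φ : Morphism W W} (hΦ : IsMinimalSeminorm J Φ) : Φ.comp Φ = Φ := by
  let M : ℕ → Morphism W W := fun n => Morphism.average n fun k => Φ.iterate (k + 1)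
  obtain ⟨Ψ, hΨ⟩ := hW ((Filter.hyperfilter ℕ).map M)
  have hlim : ∀ (x : G) (w v : W.fiber x) (c : ℝ), (∀ᶠ n in Filter.atTop,
      ‖(M n).app x w - v‖ ≤ c) → ‖Ψ.app x w - v‖ ≤ c := by
    intro x w v c h
    refine hΨ x w v c ?_
    rw [Ultrafilter.coe_map, Filter.eventually_map]
    exact h.filter_mono Nat.hyperfilter_le_atTop
  have hJ : Ψ.comp J = J := by
    refine Morphism.ext_apply fun x a => sub_eq_zero.1 (norm_le_zero_iff.1
      (hlim x (J.app x a) (J.app x a) 0 (Filter.Eventually.of_forall fun n => ?_)))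
    have h1 : Φ.app x (J.app x a) = J.app x a := Morphism.congr_apply hΦ.1 x a
    have h2 : (M n).app x (J.app x a) = J.app x a := by
      have hn : ((n : ℂ) + 1) ≠ 0 := by exact_mod_cast n.succ_ne_zero
      rw [Morphism.average_apply, Finset.sum_congr rfl fun k _ =>
        Φ.iterate_apply_of_eq h1 (k + 1), Finset.sum_const, Finset.card_range,
        ← Nat.cast_smul_eq_nsmul ℂ, smul_smul]
      push_cast
      rw [inv_mul_cancel₀ hn, one_smul]
    rw [h2, sub_self, norm_zero]
  have hle : SeminormLE Ψ Φ := by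
    intro x w
    have h := hlim x w 0 ‖Φ.app x w‖ (Filter.Eventually.of_forall fun n => ?_)
    · rwa [sub_zero] at h
    have hn : (0 : ℝ) < n + 1 := by positivity
    rw [sub_zero, Morphism.average_apply, norm_smul, Complex.norm_real,
      Real.norm_of_nonneg (inv_nonneg.2 hn.le), inv_mul_le_iff₀ hn]
    refine (norm_sum_le _ _).trans ?_
    refine (Finset.sum_le_card_nsmul _ _ ‖Φ.app x w‖ fun k _ => ?_).trans ?_
    · rw [Φ.iterate_succ_apply]
      exact ((Φ.iterate k).app x).norm_map_le _
    · rw [Finset.card_range, nsmul_eq_mul]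
      push_cast
      exact le_rfl
  have hmin := hΦ.2 Ψ hJ hle
  refine (Morphism.ext_apply fun x w => ?_)
  -- The averages telescope at `w - Φ w`.
  have hzero : ‖Ψ.app x (w - Φ.app x w)‖ ≤ 0 := by
    refine le_of_forall_pos_le_add fun ε hε => ?_
    rw [zero_add, ← sub_zero (Ψ.app x (w - Φ.app x w))]
    apply hlim
    have hlim0 : Filter.Tendsto (fun n : ℕ => (n + 1 : ℝ)⁻¹ * (2 * ‖w‖)) Filter.atTop
        (nhds 0) := by
      have := (tendsto_one_div_add_atTop_nhds_zero_nat (𝕜 := ℝ)).mul_const (2 * ‖w‖)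
      simpa using this
    filter_upwards [hlim0.eventually (ge_mem_nhds hε)] with n hn
    refine le_trans ?_ hn
    have hn : (0 : ℝ) < n + 1 := by positivity
    have htel : ∑ k ∈ Finset.range (n + 1), (Φ.iterate (k + 1)).app x (w - Φ.app x w)
        = (Φ.iterate 1).app x w - (Φ.iterate (n + 2)).app x w := by
      rw [← Finset.sum_range_sub' (fun k => (Φ.iterate (k + 1)).app x w) (n + 1)]
      refine Finset.sum_congr rfl fun k _ => ?_
      rw [map_sub, Φ.iterate_succ_apply (k + 1)]
    rw [sub_zero, Morphism.average_apply, htel, norm_smul, Complex.norm_real,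
      Real.norm_of_nonneg (inv_nonneg.2 hn.le), two_mul]
    gcongr
    refine (norm_sub_le _ _).trans (add_le_add ?_ ?_)
    · exact ((Φ.iterate 1).app x).norm_map_le _
    · exact ((Φ.iterate (n + 2)).app x).norm_map_le _
  have h := (hmin x (w - Φ.app x w)).trans hzero
  rw [norm_le_zero_iff, map_sub, sub_eq_zero] at h
  exact h.symm

theorem SeminormLE.apply_eq {Φ Ψ : Morphism W W} (h : SeminormLE Φ Ψ) {x : G} {w w' : W.fiber x}
    (hw : Ψ.app x w = Ψ.app x w') : Φ.app x w = Φ.app x w' := by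
  have h1 := h x (w - w')
  rw [map_sub, map_sub, hw, sub_self, norm_zero, norm_le_zero_iff, sub_eq_zero] at h1
  exact h1

theorem IsMinimalSeminorm.of_le {J : Morphism A W} {Φ Ψ : Morphism W W}
    (hΦ : IsMinimalSeminorm J Φ) (hΨ : Ψ.comp J = J) (h : SeminormLE Ψ Φ) :
    IsMinimalSeminorm J Ψ :=
  ⟨hΨ, fun Ω hΩ hle x w =>
    (h x w).trans (hΦ.2 Ω hΩ (fun x w => (hle x w).trans (h x w)) x w)⟩

theorem IsMinimalSeminorm.isMinimalProjection (hW : HasUltralimits W) {J : Morphism A W}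
    {Φ : Morphism W W} (hΦ : IsMinimalSeminorm J Φ) : IsMinimalProjection J Φ := by
  refine ⟨⟨hΦ.comp_self hW, hΦ.1⟩, fun Ψ hΨ h1 h2 => Morphism.ext_apply fun x w => ?_⟩
  have hle : SeminormLE Ψ Φ := by
    intro x w
    rw [← Morphism.congr_apply h2 x w]
    exact (Ψ.app x).norm_map_le _
  have h3 := (hΦ.2 Ψ hΨ.2 hle).apply_eq (Morphism.congr_apply hΨ.1 x w)
  exact (Morphism.congr_apply h1 x w).symm.trans h3

theorem IsMinimalProjection.isMinimalSeminorm (hW : HasUltralimits W) {J : Morphism A W}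
    {Θ : Morphism W W} (hΘ : IsMinimalProjection J Θ) : IsMinimalSeminorm J Θ := by
  obtain ⟨Φ, hΦ, hle⟩ := hW.exists_isMinimalSeminorm_le J Θ hΘ.1.2
  have hΦΘ : Φ.comp Θ = Φ := Morphism.ext_apply fun x w =>
    hle.apply_eq (Morphism.congr_apply hΘ.1.1 x w)
  have hJ : (Θ.comp Φ).comp J = J := by rw [Morphism.comp_assoc, hΦ.1, hΘ.1.2]
  have hmin : IsMinimalSeminorm J (Θ.comp Φ) :=
    hΦ.of_le hJ fun x w => (Θ.app x).norm_map_le _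
  have h : Θ.comp Φ = Θ := by
    apply hΘ.2 _ ⟨hmin.comp_self hW, hJ⟩
    · rw [← Morphism.comp_assoc, hΘ.1.1]
    · rw [Morphism.comp_assoc, hΦΘ]
  exact h ▸ hmin

/-- The corner of any endomorphism that fixes `A` at an endomorphism with minimal seminorm is
trivial. -/
theorem IsMinimalSeminorm.comp_comp_eq (hW : HasUltralimits W) {J : Morphism A W}
    {Φ Ψ : Morphism W W} (hΦ : IsMinimalSeminorm J Φ) (hΨ : Ψ.comp J = J) :
    Φ.comp (Ψ.comp Φ) = Φ := by
  have hJ : (Φ.comp (Ψ.comp Φ)).comp J = J := by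
    rw [Morphism.comp_assoc, Morphism.comp_assoc, hΦ.1, hΨ, hΦ.1]
  have hle : SeminormLE (Φ.comp (Ψ.comp Φ)) Φ := fun x w =>
    ((Φ.app x).norm_map_le _).trans ((Ψ.app x).norm_map_le _)
  have hidem := (hΦ.of_le hJ hle).comp_self hW
  refine Morphism.ext_apply fun x w => ?_
  have h := (hΦ.2 _ hJ hle).apply_eq (Morphism.congr_apply hidem x w)
  rw [Morphism.comp_apply] at h
  exact (Morphism.congr_apply (hΦ.comp_self hW) x _).symm.trans h

/-- The range of an endomorphism with minimal seminorm is a rigid injective extension of `A`. -/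
theorem IsMinimalSeminorm.exists_range (hW : HasUltralimits W) (hinj : W.IsInjective)
    {J : Morphism A W} (hJ : J.IsEmbedding) {Φ : Morphism W W} (hΦ : IsMinimalSeminorm J Φ) :
    ∃ (S : Subsystem W) (Υ : Morphism A S.toSystem), S.IsRange Φ ∧ S.inclusion.comp Υ = J ∧
      Υ.IsEmbedding ∧ S.toSystem.IsInjective ∧ Υ.IsRigid := by
  have hidem := hΦ.comp_self hW
  let S := Subsystem.ofIdempotent Φ hidem
  have hmem : ∀ x a, (Φ.app x a : (W.fiber x).Ambient) ∈ S.carrier x := fun x a =>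
    Subsystem.mem_ofIdempotent.2 ⟨a, rfl⟩
  have hmemJ : ∀ x a, (J.app x a : (W.fiber x).Ambient) ∈ S.carrier x := fun x a =>
    Subsystem.mem_ofIdempotent.2 ⟨J.app x a, Morphism.congr_apply hΦ.1 x a⟩
  let Υ : Morphism A S.toSystem := S.codRestrict J hmemJ
  have hΥ : S.inclusion.comp Υ = J := rfl
  refine ⟨S, Υ, Subsystem.isRange_ofIdempotent _ _, hΥ, ?_, hinj.ofIdempotent _ _, ?_⟩
  · exact Morphism.isEmbedding_of_comp (Ψ := S.inclusion) (hΥ.symm ▸ hJ)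
  intro Ψ hΨ x w
  let r : Morphism W S.toSystem := S.codRestrict Φ hmem
  have hr : ∀ (x : G) (v : S.toSystem.fiber x), Φ.app x (S.inclusion.app x v)
      = S.inclusion.app x v := by
    intro x v
    obtain ⟨b, hb⟩ := (Subsystem.mem_ofIdempotent (hE := hidem)
      (b := S.inclusion.app x v)).1 v.2
    rw [← hb]
    exact Morphism.congr_apply hidem x b
  have hrJ : r.comp J = Υ := by
    refine Morphism.ext_apply fun x a => ?_
    have h : Φ.app x (J.app x a) = J.app x a := Morphism.congr_apply hΦ.1 x a
    have h' := congrArg Subtype.val h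
    exact Subtype.ext h'
  have hfix : (S.inclusion.comp (Ψ.comp r)).comp J = J := by
    rw [Morphism.comp_assoc, Morphism.comp_assoc, hrJ, hΨ, hΥ]
  have h := Morphism.congr_apply (hΦ.comp_comp_eq hW hfix) x (S.inclusion.app x w)
  have h1 : Φ.app x (S.inclusion.app x (Ψ.app x (r.app x (Φ.app x (S.inclusion.app x w)))))
      = Φ.app x (S.inclusion.app x w) := h
  have h2 : r.app x (Φ.app x (S.inclusion.app x w)) = w := by
    rw [hr]
    have h' := congrArg Subtype.val (hr x w)
    exact Subtype.ext h'
  rw [h2, hr, hr] at h1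
  exact (S.isEmbedding_inclusion x).1 h1

end GroupoidDynamicalSystem

/-! ### Matrices of operators and of operator-valued functions -/

section Operators

open scoped ComplexOrder InnerProductSpace

variable {H : Type*} [NormedAddCommGroup H] [InnerProductSpace ℂ H]

theorem norm_le_of_norm_inner_le {T : H →L[ℂ] H} {C : ℝ} (hC : 0 ≤ C)
    (h : ∀ ξ η, ‖⟪ξ, T η⟫_ℂ‖ ≤ C * ‖ξ‖ * ‖η‖) : ‖T‖ ≤ C := by
  refine T.opNorm_le_bound hC fun η => ?_
  rcases (norm_nonneg (T η)).eq_or_lt with h0 | h0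
  · rw [← h0]
    positivity
  · have h1 := h (T η) η
    rw [inner_self_eq_norm_sq_to_K, norm_pow, RCLike.norm_ofReal, abs_of_pos h0] at h1
    nlinarith

variable [CompleteSpace H]

/-- Bounded sesquilinear forms come from bounded operators. -/
theorem exists_inner_eq_of_form (S : H → H → ℂ) (C : ℝ)
    (add_left : ∀ ξ ξ' η, S (ξ + ξ') η = S ξ η + S ξ' η)
    (smul_left : ∀ (c : ℂ) ξ η, S (c • ξ) η = star c * S ξ η)
    (add_right : ∀ ξ η η', S ξ (η + η') = S ξ η + S ξ η')
    (smul_right : ∀ (c : ℂ) ξ η, S ξ (c • η) = c * S ξ η)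
    (bound : ∀ ξ η, ‖S ξ η‖ ≤ C * ‖ξ‖ * ‖η‖) :
    ∃ T : H →L[ℂ] H, ∀ ξ η, ⟪ξ, T η⟫_ℂ = S ξ η := by
  let L : H →ₗ⋆[ℂ] H →ₗ[ℂ] ℂ :=
    LinearMap.mk₂'ₛₗ (starRingEnd ℂ) (RingHom.id ℂ) S add_left smul_left add_right smul_right
  refine ⟨ContinuousLinearMap.adjoint
    (InnerProductSpace.continuousLinearMapOfBilin (L.mkContinuous₂ C bound)), fun ξ η => ?_⟩
  rw [ContinuousLinearMap.adjoint_inner_right,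
    InnerProductSpace.continuousLinearMapOfBilin_apply]
  rfl

theorem exists_eq_star_mul_self (T : H →L[ℂ] H) (h : ∀ v, 0 ≤ ⟪v, T v⟫_ℂ) :
    ∃ R : H →L[ℂ] H, T = star R * R := by
  have hpos : 0 ≤ T := by
    rw [ContinuousLinearMap.nonneg_iff_isPositive, ContinuousLinearMap.isPositive_iff_complex]
    intro v
    have h2 : ⟪T v, v⟫_ℂ = ⟪v, T v⟫_ℂ := by
      rw [← inner_conj_symm]
      exact Complex.conj_eq_iff_im.2 (Complex.nonneg_iff.1 (h v)).2.symm
    rw [h2]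
    exact ⟨Complex.ext rfl (Complex.nonneg_iff.1 (h v)).2, (Complex.nonneg_iff.1 (h v)).1⟩
  exact CStarAlgebra.nonneg_iff_eq_star_mul_self.1 hpos

variable {n : Type*} [Fintype n]

/-- A matrix of operators is positive if and only if its quadratic form is positive. -/
theorem isGram_iff_inner_nonneg {M : Matrix n n (H →L[ℂ] H)} :
    IsGram M ↔ ∀ ξ : n → H, 0 ≤ ∑ i, ∑ j, ⟪ξ i, M i j (ξ j)⟫_ℂ := by
  classical
  constructor
  · rintro ⟨N, rfl⟩ ξ
    have h : ∑ i, ∑ j, ⟪ξ i, (N.conjTranspose * N) i j (ξ j)⟫_ℂ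
        = ∑ k, ⟪∑ i, N k i (ξ i), ∑ j, N k j (ξ j)⟫_ℂ := by
      simp only [Matrix.mul_apply, Matrix.conjTranspose_apply, _root_.sum_apply,
        inner_sum, sum_inner, ContinuousLinearMap.star_eq_adjoint, mul_apply_eq_comp,
        ContinuousLinearMap.adjoint_inner_right]
      rw [Finset.sum_congr rfl fun i _ => Finset.sum_comm, Finset.sum_comm]
      exact Finset.sum_congr rfl fun k _ => Finset.sum_comm
    rw [h]
    refine Finset.sum_nonneg fun k _ => ?_
    rw [inner_self_eq_norm_sq_to_K, ← RCLike.ofReal_pow]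
    exact RCLike.ofReal_nonneg.2 (sq_nonneg _)
  · intro h
    let e := PiLp.continuousLinearEquiv 2 ℂ fun _ : n => H
    let inc : n → H →L[ℂ] PiLp 2 fun _ : n => H := fun i =>
      (e.symm : (n → H) →L[ℂ] PiLp 2 fun _ : n => H) ∘L ContinuousLinearMap.single ℂ (fun _ => H) i
    let pr : n → (PiLp 2 fun _ : n => H) →L[ℂ] H := fun i => PiLp.proj 2 (fun _ => H) i
    let T : (PiLp 2 fun _ : n => H) →L[ℂ] PiLp 2 fun _ : n => H :=
      (e.symm : (n → H) →L[ℂ] PiLp 2 fun _ : n => H) ∘L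
        ContinuousLinearMap.pi fun i => ∑ j, M i j ∘L pr j
    have hT : ∀ v w, ⟪v, T w⟫_ℂ = ∑ i, ∑ j, ⟪v i, M i j (w j)⟫_ℂ := by
      intro v w
      rw [PiLp.inner_apply]
      refine Finset.sum_congr rfl fun i _ => ?_
      rw [← inner_sum]
      congr 1
      simp [T, e, pr]
    obtain ⟨R, hR⟩ := exists_eq_star_mul_self T fun v => by
      rw [hT]
      exact h v
    refine ⟨Matrix.of fun k i => pr k ∘L R ∘L inc i, ?_⟩
    ext i j η
    refine ext_inner_left ℂ fun ξ => ?_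
    have h1 : ⟪ξ, M i j η⟫_ℂ = ⟪inc i ξ, T (inc j η)⟫_ℂ := by
      rw [hT, Finset.sum_eq_single i, Finset.sum_eq_single j]
      · simp [inc, e]
      · intro b _ hb
        simp [inc, e, hb]
      · simp
      · intro b _ hb
        simp [inc, e, hb]
      · simp
    rw [h1, hR, mul_apply_eq_comp, ContinuousLinearMap.star_eq_adjoint,
      ContinuousLinearMap.adjoint_inner_right, PiLp.inner_apply]
    simp only [Matrix.mul_apply, Matrix.conjTranspose_apply, _root_.sum_apply,
        inner_sum, ContinuousLinearMap.star_eq_adjoint, mul_apply_eq_comp,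
        ContinuousLinearMap.adjoint_inner_right, Matrix.of_apply, ContinuousLinearMap.comp_apply]
    rfl

end Operators

/-- The entries of a square root of a positive matrix are bounded by its diagonal entries. -/
theorem norm_sq_le_of_gram {B : Type*} [CStarAlgebra B] {n : Type*} [Fintype n]
    {M N : Matrix n n B} (h : M = N.conjTranspose * N) (i j : n) : ‖N i j‖ ^ 2 ≤ ‖M j j‖ := by
  let _ := CStarAlgebra.spectralOrder B
  let _ := CStarAlgebra.spectralOrderedRing B
  rw [sq, ← CStarRing.norm_star_mul_self]
  refine CStarAlgebra.norm_le_norm_of_nonneg_of_le (star_mul_self_nonneg _) ?_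
  rw [h, Matrix.mul_apply]
  exact Finset.single_le_sum (f := fun k => star (N k j) * N k j)
    (fun k _ => star_mul_self_nonneg _) (Finset.mem_univ i)

/-- A matrix of bounded functions is positive if and only if it is so pointwise. -/
theorem isGram_boundedFunction_iff {X : Type*} [TopologicalSpace X] [DiscreteTopology X]
    {B : Type*} [CStarAlgebra B] {n : Type*} [Fintype n] {M : Matrix n n (X →ᵇ B)} :
    IsGram M ↔ ∀ x, IsGram (M.map fun f => f x) := by
  constructor
  · rintro ⟨N, rfl⟩ x
    refine ⟨N.map fun f => f x, ?_⟩
    ext i j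
    simp [Matrix.mul_apply, BoundedContinuousFunction.sum_apply]
  · intro h
    choose N hN using h
    have hb : ∀ i j x, ‖N x i j‖ ≤ Real.sqrt ‖M j j‖ := fun i j x =>
      Real.le_sqrt_of_sq_le
        ((norm_sq_le_of_gram (hN x) i j).trans ((M j j).norm_coe_le_norm x))
    refine ⟨Matrix.of fun i j => BoundedContinuousFunction.ofNormedAddCommGroupDiscrete
      (fun x => N x i j) (Real.sqrt ‖M j j‖) (hb i j), ?_⟩
    ext i j x
    have h1 := congrFun (congrFun (hN x) i) j
    rw [Matrix.map_apply, Matrix.mul_apply] at h1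
    rw [h1, Matrix.mul_apply, BoundedContinuousFunction.sum_apply]
    rfl

/-! ### Arveson's extension theorem -/

section BasisForm

open scoped InnerProductSpace

variable {H : Type*} [NormedAddCommGroup H] [InnerProductSpace ℂ H] {I : Type*}

/-- For a linear functional `g` on finitely supported `B`-valued matrices indexed by a basis of `H`,
the value of `g` at the matrix with entries `conj ξᵢ ηⱼ b`. -/
noncomputable def basisForm (e : Module.Basis I ℂ H) {B : OperatorSystem.{u}}
    (g : (I × I →₀ B) →ₗ[ℂ] ℂ) (ξ η : H) : B →ₗ[ℂ] ℂ :=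
  (e.repr ξ).sum fun i c => (e.repr η).sum fun k d =>
    (star c * d) • (g ∘ₗ Finsupp.lsingle (i, k))

variable (e : Module.Basis I ℂ H) {B : OperatorSystem.{u}} (g : (I × I →₀ B) →ₗ[ℂ] ℂ)

theorem basisForm_apply_of_subset {ξ η : H} {s : Finset I} (hξ : (e.repr ξ).support ⊆ s)
    (hη : (e.repr η).support ⊆ s) (b : B) :
    basisForm e g ξ η b = ∑ i ∈ s, ∑ k ∈ s,
      (star (e.repr ξ i) * e.repr η k) * g (Finsupp.single (i, k) b) := by
  rw [basisForm, Finsupp.sum_of_support_subset _ hξ _ (by simp), LinearMap.sum_apply]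
  refine Finset.sum_congr rfl fun i _ => ?_
  rw [Finsupp.sum_of_support_subset _ hη _ (by simp), LinearMap.sum_apply]
  rfl

theorem basisForm_add_left (ξ ξ' η : H) :
    basisForm e g (ξ + ξ') η = basisForm e g ξ η + basisForm e g ξ' η := by
  classical
  rw [basisForm, map_add]
  refine Finsupp.sum_add_index' (fun i => by simp) fun i c c' => ?_
  rw [← Finsupp.sum_add]
  refine Finsupp.sum_congr fun k _ => ?_
  rw [star_add, add_mul, add_smul]

theorem basisForm_smul_left (c : ℂ) (ξ η : H) :
    basisForm e g (c • ξ) η = star c • basisForm e g ξ η := by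
  rw [basisForm, map_smul, Finsupp.sum_smul_index' (fun i => by simp), basisForm, Finsupp.smul_sum]
  refine Finsupp.sum_congr fun i _ => ?_
  rw [Finsupp.smul_sum]
  refine Finsupp.sum_congr fun k _ => ?_
  rw [smul_eq_mul, star_mul', mul_assoc, mul_smul]

theorem basisForm_add_right (ξ η η' : H) :
    basisForm e g ξ (η + η') = basisForm e g ξ η + basisForm e g ξ η' := by
  classical
  rw [basisForm, map_add, basisForm, basisForm, ← Finsupp.sum_add]
  refine Finsupp.sum_congr fun i _ => ?_
  refine Finsupp.sum_add_index' (fun i => by simp) fun k d d' => ?_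
  rw [mul_add, add_smul]

theorem basisForm_smul_right (c : ℂ) (ξ η : H) :
    basisForm e g ξ (c • η) = c • basisForm e g ξ η := by
  rw [basisForm, basisForm, Finsupp.smul_sum]
  refine Finsupp.sum_congr fun i _ => ?_
  rw [map_smul, Finsupp.sum_smul_index' (fun i => by simp), Finsupp.smul_sum]
  refine Finsupp.sum_congr fun k _ => ?_
  rw [smul_eq_mul, mul_left_comm, mul_smul]

/-- The form is determined by its values at the basis. -/
theorem basisForm_eq_inner {b : B} {T : H →L[ℂ] H}
    (h : ∀ i k, g (Finsupp.single (i, k) b) = ⟪e i, T (e k)⟫_ℂ) (ξ η : H) :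
    basisForm e g ξ η b = ⟪ξ, T η⟫_ℂ := by
  classical
  let s := (e.repr ξ).support ∪ (e.repr η).support
  rw [basisForm_apply_of_subset e g (s := s) Finset.subset_union_left Finset.subset_union_right]
  have expand : ∀ v : H, (e.repr v).support ⊆ s → v = ∑ i ∈ s, e.repr v i • e i := by
    intro v hv
    conv_lhs => rw [← e.linearCombination_repr v]
    rw [Finsupp.linearCombination_apply, Finsupp.sum_of_support_subset _ hv _ (by simp)]
  conv_rhs => rw [expand ξ Finset.subset_union_left, expand η Finset.subset_union_right]
  rw [sum_inner]
  refine Finset.sum_congr rfl fun i _ => ?_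
  rw [map_sum, inner_sum]
  refine Finset.sum_congr rfl fun k _ => ?_
  rw [h, map_smul, inner_smul_left, inner_smul_right, mul_assoc]
  rfl

end BasisForm

section Arveson

open scoped ComplexOrder InnerProductSpace
open OperatorSystem

/-- The operator system of all bounded operators on `H`. -/
noncomputable abbrev OperatorSystem.operators (H : Type u) [NormedAddCommGroup H]
    [InnerProductSpace ℂ H] [CompleteSpace H] : OperatorSystem.{u} :=
  OperatorSystem.ofCStarAlgebra (H →L[ℂ] H)

/-- An element of the operator system `B(H)`, as an operator. -/
def OperatorSystem.op {H : Type u} [NormedAddCommGroup H] [InnerProductSpace ℂ H] [CompleteSpace H]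
    (T : OperatorSystem.operators H) : H →L[ℂ] H := T.1

variable {H : Type u} [NormedAddCommGroup H] [InnerProductSpace ℂ H] [CompleteSpace H]

theorem matPos_operators_iff {n : ℕ} {M : Matrix (Fin n) (Fin n) (operators H)} :
    (operators H).MatPos M ↔ ∀ ξ : Fin n → H, 0 ≤ ∑ i, ∑ j, ⟪ξ i, op (M i j) (ξ j)⟫_ℂ :=
  isGram_iff_inner_nonneg (M := Matrix.of fun i j => op (M i j))

/-- A family of sesquilinear forms on `H` indexed linearly by `B`, which is positive on positive
matrices and equal to the inner product at the unit, comes from a unital completely positive map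
into `B(H)`. -/
theorem exists_ucpMap_of_form {B : OperatorSystem.{u}} (S : H → H → B →ₗ[ℂ] ℂ)
    (add_left : ∀ ξ ξ' η b, S (ξ + ξ') η b = S ξ η b + S ξ' η b)
    (smul_left : ∀ (c : ℂ) ξ η b, S (c • ξ) η b = star c * S ξ η b)
    (add_right : ∀ ξ η η' b, S ξ (η + η') b = S ξ η b + S ξ η' b)
    (smul_right : ∀ (c : ℂ) ξ η b, S ξ (c • η) b = c * S ξ η b)
    (map_one : ∀ ξ η, S ξ η 1 = ⟪ξ, η⟫_ℂ)
    (pos : ∀ (n : ℕ) (M : Matrix (Fin n) (Fin n) B), B.MatPos M → ∀ ξ : Fin n → H,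
      0 ≤ ∑ i, ∑ j, S (ξ i) (ξ j) (M i j)) :
    ∃ θ : UCPMap B (operators H), ∀ b ξ η, ⟪ξ, op (θ b) η⟫_ℂ = S ξ η b := by
  -- Positivity of the matrix with rows `‖b‖, b` and `b*, ‖b‖` bounds the form at `b`.
  have two : ∀ b ξ η, 0 ≤ (‖b‖ : ℂ) * ⟪ξ, ξ⟫_ℂ + S ξ η b + (S η ξ (star b)
      + (‖b‖ : ℂ) * ⟪η, η⟫_ℂ) := by
    intro b ξ η
    have h := pos 2 _ ((matPos_iff_norm_le (norm_nonneg b)).2 le_rfl) ![ξ, η]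
    simpa [Fin.sum_univ_two, -Complex.coe_smul, map_one] using h
  have self_im : ∀ ξ : H, (⟪ξ, ξ⟫_ℂ).im = 0 := fun ξ => inner_self_im (𝕜 := ℂ) ξ
  have conj : ∀ b ξ η, S η ξ (star b) = star (S ξ η b) := by
    intro b ξ η
    have h1 := (Complex.nonneg_iff.1 (two b ξ η)).2
    have h2 := (Complex.nonneg_iff.1 (two b ξ (Complex.I • η))).2
    rw [smul_left, smul_right] at h2
    have e1 := self_im ξ
    have e2 := self_im η
    have e3 := self_im (Complex.I • η)
    simp only [Complex.add_im, Complex.mul_im, Complex.ofReal_re, Complex.ofReal_im, e1, e2, e3,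
      Complex.I_re, Complex.I_im, Complex.star_def, Complex.conj_re, Complex.conj_im] at h1 h2
    refine Complex.ext ?_ ?_ <;> simp only [Complex.star_def, Complex.conj_re, Complex.conj_im] <;>
      linarith
  have zero_left : ∀ η b, S 0 η b = 0 := by
    intro η b
    have h := smul_left 0 0 η b
    rwa [zero_smul, star_zero, zero_mul] at h
  have zero_right : ∀ ξ b, S ξ 0 b = 0 := by
    intro ξ b
    have h := smul_right 0 ξ 0 b
    rwa [zero_smul, zero_mul] at h
  have unit_bound : ∀ b ξ η, ‖ξ‖ = 1 → ‖η‖ = 1 → ‖S ξ η b‖ ≤ ‖b‖ := by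
    intro b ξ η hξ hη
    -- Rotate `η` so that the form becomes a negative real number.
    obtain ⟨c, hc, hcS⟩ : ∃ c : ℂ, ‖c‖ = 1 ∧ c * S ξ η b = -(‖S ξ η b‖ : ℂ) := by
      rcases eq_or_ne (S ξ η b) 0 with h0 | h0
      · exact ⟨1, norm_one, by simp [h0]⟩
      · have h1 : (‖S ξ η b‖ : ℂ) ≠ 0 := Complex.ofReal_ne_zero.2 (norm_ne_zero_iff.2 h0)
        refine ⟨-(‖S ξ η b‖ : ℂ) / S ξ η b, ?_, div_mul_cancel₀ _ h0⟩
        rw [norm_div, norm_neg, Complex.norm_real, norm_norm, div_self (norm_ne_zero_iff.2 h0)]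
    have h := (Complex.nonneg_iff.1 (two b ξ (c • η))).1
    have e1 : ⟪ξ, ξ⟫_ℂ = 1 := by rw [inner_self_eq_norm_sq_to_K, hξ]; simp
    have e2 : ⟪c • η, c • η⟫_ℂ = 1 := by
      rw [inner_self_eq_norm_sq_to_K, norm_smul, hη, hc]; simp
    rw [conj, smul_right, hcS, e1, e2] at h
    simp at h
    have hb : ‖(b : B.Ambient)‖ = ‖b‖ := rfl
    linarith
  have bound : ∀ b ξ η, ‖S ξ η b‖ ≤ ‖b‖ * ‖ξ‖ * ‖η‖ := by
    intro b ξ η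
    rcases eq_or_ne ξ 0 with rfl | hξ
    · simp [zero_left]
    rcases eq_or_ne η 0 with rfl | hη
    · simp [zero_right]
    have hξ' := norm_ne_zero_iff.2 hξ
    have hη' := norm_ne_zero_iff.2 hη
    have h := unit_bound b (((‖ξ‖⁻¹ : ℝ) : ℂ) • ξ) (((‖η‖⁻¹ : ℝ) : ℂ) • η)
      (by rw [norm_smul, Complex.norm_real, norm_inv, norm_norm, inv_mul_cancel₀ hξ'])
      (by rw [norm_smul, Complex.norm_real, norm_inv, norm_norm, inv_mul_cancel₀ hη'])
    rw [smul_left, smul_right, norm_mul, norm_mul, norm_star, Complex.norm_real,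
      Complex.norm_real, norm_inv, norm_inv, norm_norm, norm_norm] at h
    have hp : 0 < ‖ξ‖ := norm_pos_iff.2 hξ
    have hq : 0 < ‖η‖ := norm_pos_iff.2 hη
    rwa [inv_mul_le_iff₀ hp, inv_mul_le_iff₀ hq, ← mul_assoc, mul_comm, ← mul_assoc,
      mul_right_comm, mul_assoc, ← mul_assoc] at h
  choose T hT using fun b => exists_inner_eq_of_form (fun ξ η => S ξ η b) ‖b‖
    (fun ξ ξ' η => add_left ξ ξ' η b) (fun c ξ η => smul_left c ξ η b)
    (fun ξ η η' => add_right ξ η η' b) (fun c ξ η => smul_right c ξ η b) (bound b)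
  let L : B →ₗ[ℂ] H →L[ℂ] H :=
    { toFun := T
      map_add' := fun b b' => by
        ext η
        refine ext_inner_left ℂ fun ξ => ?_
        rw [hT, map_add, _root_.add_apply, inner_add_right, hT, hT]
      map_smul' := fun c b => by
        ext η
        refine ext_inner_left ℂ fun ξ => ?_
        rw [hT, map_smul, RingHom.id_apply, _root_.smul_apply, inner_smul_right, hT,
          smul_eq_mul] }
  refine ⟨⟨LinearMap.codRestrict (⊤ : Submodule ℂ (H →L[ℂ] H)) L fun _ => Submodule.mem_top,
    ?_, ?_⟩, hT⟩
  · refine Subtype.ext (?_ : T 1 = 1)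
    ext η
    refine ext_inner_left ℂ fun ξ => ?_
    rw [hT, map_one]
    rfl
  · intro n M hM
    rw [matPos_operators_iff]
    intro ξ
    have h := pos n M hM ξ
    simp only [← hT] at h
    exact h

/-- A complex version of the M. Riesz extension theorem: a complex functional on a subspace whose
real part is positive on a cone extends with the same property. -/
theorem exists_complex_extension {F E : Type*} [AddCommGroup F] [Module ℂ F] [AddCommGroup E]
    [Module ℂ E] (j : F →ₗ[ℂ] E) (hj : Function.Injective j) (f : F →ₗ[ℂ] ℂ) (P : E → Prop)
    (zero : P 0) (add : ∀ y z, P y → P z → P (y + z))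
    (smul : ∀ (r : ℝ) y, 0 ≤ r → P y → P ((r : ℂ) • y))
    (pos : ∀ x, P (j x) → 0 ≤ (f x).re) (dense : ∀ y, ∃ x, P (j x + y)) :
    ∃ g : E →ₗ[ℂ] ℂ, (∀ x, g (j x) = f x) ∧ ∀ y, P y → 0 ≤ (g y).re := by
  let s : PointedCone ℝ E :=
    { carrier := {y | P y}
      zero_mem' := zero
      add_mem' := fun {y z} hy hz => add y z hy hz
      smul_mem' := fun r y hy => by
        have h := smul r.1 y r.2 hy
        rw [Complex.coe_smul] at h
        exact h }
  let jr : F →ₗ[ℝ] E := j.restrictScalars ℝ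
  let ej : F ≃ₗ[ℝ] LinearMap.range jr := LinearEquiv.ofInjective jr hj
  let p : E →ₗ.[ℝ] ℝ :=
    ⟨LinearMap.range jr, Complex.reLm ∘ₗ (f.restrictScalars ℝ) ∘ₗ ej.symm.toLinearMap⟩
  have hp : ∀ (x : F) (h : jr x ∈ p.domain), p ⟨jr x, h⟩ = (f x).re := by
    intro x h
    have : ej.symm ⟨jr x, h⟩ = x := by
      rw [LinearEquiv.symm_apply_eq]
      rfl
    change (f (ej.symm ⟨jr x, h⟩)).re = _
    rw [this]
  obtain ⟨g, hg, hgs⟩ := riesz_extension s p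
    (by
      rintro ⟨_, ⟨x, rfl⟩⟩ hx
      exact (pos x hx).trans_eq (hp x _).symm)
    (fun y => by
      obtain ⟨x, hx⟩ := dense y
      exact ⟨⟨jr x, ⟨x, rfl⟩⟩, hx⟩)
  have hre : ∀ x, g (j x) = (f x).re := fun x =>
    (hg ⟨jr x, ⟨x, rfl⟩⟩).trans (hp x _)
  refine ⟨Module.Dual.extendRCLike (𝕜 := ℂ) g, fun x => ?_, fun y hy => ?_⟩
  · refine Complex.ext ?_ ?_
    · exact (Module.Dual.re_extendRCLike_apply (𝕜 := ℂ) g (j x)).trans (hre x)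
    · refine (Module.Dual.im_extendRCLike_apply (𝕜 := ℂ) g (j x)).trans ?_
      have h := hre (Complex.I • x)
      rw [map_smul] at h
      change -g (Complex.I • j x) = _
      rw [h, map_smul]
      simp
  · have h := Module.Dual.re_extendRCLike_apply (𝕜 := ℂ) g y
    exact (hgs y hy).trans_eq h.symm

end Arveson

section Arveson

open scoped ComplexOrder InnerProductSpace
open OperatorSystem

variable {A B : OperatorSystem.{u}} {I : Type*}

/-- Twice the real part of the submatrix of `Y` that belongs to a finite family of indices. -/
noncomputable def doubleReal (Y : I × I →₀ B) {n : ℕ} (t : Fin n → I) : Matrix (Fin n) (Fin n) B :=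
  Matrix.of fun i k => Y (t i, t k) + star (Y (t k, t i))

/-- All finite submatrices of `Y` have positive real part. -/
def IsRealPositive (Y : I × I →₀ B) : Prop :=
  ∀ (n : ℕ) (t : Fin n → I), B.MatPos (doubleReal Y t)

theorem IsRealPositive.add {Y Z : I × I →₀ B} (hY : IsRealPositive Y) (hZ : IsRealPositive Z) :
    IsRealPositive (Y + Z) := by
  intro n t
  convert (hY n t).add (hZ n t) using 1
  ext i k
  simp only [doubleReal, Matrix.of_apply, Matrix.add_apply, Finsupp.add_apply, star_add]
  congr 1
  abel

theorem IsRealPositive.smul {Y : I × I →₀ B} (hY : IsRealPositive Y) {r : ℝ} (hr : 0 ≤ r) :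
    IsRealPositive ((r : ℂ) • Y) := by
  intro n t
  convert (hY n t).smul hr using 1
  ext i k
  simp only [doubleReal, Matrix.of_apply, Matrix.smul_apply, Finsupp.smul_apply, star_smul,
    smul_add, Complex.star_def, Complex.conj_ofReal]

theorem isRealPositive_of_skew {Y : I × I →₀ B} (h : ∀ i k, star (Y (k, i)) = -Y (i, k)) :
    IsRealPositive Y := by
  intro n t
  convert (matPos_zero : B.MatPos (0 : Matrix (Fin n) (Fin n) B)) using 1
  ext i k
  simp [doubleReal, h]

/-- Adding a large multiple of the unit on the diagonal makes the real part of a finitely supported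
matrix positive. -/
theorem exists_isRealPositive_add [DecidableEq I] (Y : I × I →₀ B) :
    ∃ (s : Finset I) (c : ℝ),
      IsRealPositive (∑ i ∈ s, Finsupp.single (i, i) ((c : ℂ) • (1 : B)) + Y) := by
  let s : Finset I := Y.support.image Prod.fst ∪ Y.support.image Prod.snd
  have hs1 : ∀ i k, i ∉ s → Y (i, k) = 0 := by
    intro i k hi
    by_contra h
    exact hi (Finset.mem_union_left _
      (Finset.mem_image.2 ⟨(i, k), Finsupp.mem_support_iff.2 h, rfl⟩))
  have hs2 : ∀ i k, k ∉ s → Y (i, k) = 0 := by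
    intro i k hk
    by_contra h
    exact hk (Finset.mem_union_right _
      (Finset.mem_image.2 ⟨(i, k), Finsupp.mem_support_iff.2 h, rfl⟩))
  let Z : Matrix s s B.Ambient := Matrix.of fun i k =>
    (Y (i.1, k.1) : B.Ambient) + star (Y (k.1, i.1) : B.Ambient)
  have hZ : Z.conjTranspose = Z := by
    ext i k
    simp [Z, Matrix.conjTranspose_apply, add_comm]
  obtain ⟨c, hc, hcZ⟩ := exists_isGram_smul_one_add hZ
  refine ⟨s, c / 2, fun n t => ?_⟩
  rw [matPos_iff_isGram]
  -- A submatrix is a compression of the submatrix over the support by a zero-one matrix.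
  let V : Matrix s (Fin n) B.Ambient := Matrix.of fun i k => if i.1 = t k then 1 else 0
  convert hcZ.conj V using 1
  have hdiag : ∀ p q : I, ((∑ i ∈ s, Finsupp.single (i, i) (((c / 2 : ℝ) : ℂ) • (1 : B)) :
      I × I →₀ B) (p, q)) = if p = q ∧ p ∈ s then ((c / 2 : ℝ) : ℂ) • (1 : B) else 0 := by
    intro p q
    rw [Finsupp.finsetSum_apply]
    simp only [Finsupp.single_apply, Prod.mk.injEq]
    by_cases hpq : p = q
    · subst hpq
      simp
    · rw [if_neg (fun h => hpq h.1)]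
      refine Finset.sum_eq_zero fun i _ => if_neg ?_
      rintro ⟨rfl, rfl⟩
      exact hpq rfl
  have hV : ∀ (N : Matrix s s B.Ambient) (i k : Fin n), (V.conjTranspose * N * V) i k
      = if h : t i ∈ s ∧ t k ∈ s then N ⟨t i, h.1⟩ ⟨t k, h.2⟩ else 0 := by
    intro N i k
    have hcol : ∀ (l : Fin n) (h : t l ∈ s) (f : s → B.Ambient),
        ∑ a, f a * V a l = f ⟨t l, h⟩ := by
      intro l h f
      rw [Finset.sum_eq_single (⟨t l, h⟩ : s)]
      · simp [V]
      · intro a _ ha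
        have : a.1 ≠ t l := fun h' => ha (Subtype.ext h')
        simp [V, this]
      · simp
    have hrow : ∀ (l : Fin n) (h : t l ∈ s) (f : s → B.Ambient),
        ∑ a, star (V a l) * f a = f ⟨t l, h⟩ := by
      intro l h f
      rw [Finset.sum_eq_single (⟨t l, h⟩ : s)]
      · simp [V]
      · intro a _ ha
        have : a.1 ≠ t l := fun h' => ha (Subtype.ext h')
        simp [V, this]
      · simp
    have hzero : ∀ l : Fin n, t l ∉ s → ∀ a, V a l = 0 := by
      intro l h a
      have : a.1 ≠ t l := fun h' => h (h' ▸ a.2)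
      simp [V, this]
    by_cases h : t i ∈ s ∧ t k ∈ s
    · rw [dif_pos h, Matrix.mul_apply, hcol k h.2]
      exact hrow i h.1 fun a => N a ⟨t k, h.2⟩
    · rw [dif_neg h, Matrix.mul_apply]
      refine Finset.sum_eq_zero fun b _ => ?_
      by_cases hk : t k ∈ s
      · have hi : t i ∉ s := fun hi => h ⟨hi, hk⟩
        rw [Matrix.mul_apply, Finset.sum_eq_zero, zero_mul]
        intro a _
        rw [Matrix.conjTranspose_apply, hzero i hi, star_zero, zero_mul]
      · rw [hzero k hk, mul_zero]
  have half : ((c / 2 : ℝ) : ℂ) • (1 : B.Ambient) + ((c / 2 : ℝ) : ℂ) • (1 : B.Ambient)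
      = (c : ℂ) • (1 : B.Ambient) := by
    rw [← add_smul, ← Complex.ofReal_add, add_halves]
  have star_half : star (((c / 2 : ℝ) : ℂ) • (1 : B.Ambient))
      = ((c / 2 : ℝ) : ℂ) • (1 : B.Ambient) := by
    rw [star_smul, star_one, Complex.star_def, Complex.conj_ofReal]
  ext i k
  rw [hV]
  simp only [Matrix.map_apply, doubleReal, Matrix.of_apply, Finsupp.add_apply, hdiag]
  by_cases hi : t i ∈ s
  · by_cases hk : t k ∈ s
    · rw [dif_pos ⟨hi, hk⟩]
      by_cases hik : t i = t k
      · rw [if_pos ⟨hik, hi⟩, if_pos ⟨hik.symm, hk⟩]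
        have hik' : (⟨t i, hi⟩ : s) = ⟨t k, hk⟩ := Subtype.ext hik
        simp only [Matrix.add_apply, Matrix.smul_apply, Matrix.one_apply_eq, ← half, Z,
          Matrix.of_apply, hik]
        simp only [Submodule.coe_add, coe_star, star_add, Submodule.coe_smul]
        change _ • (1 : B.Ambient) + _ + (star (_ • (1 : B.Ambient)) + _) = _
        rw [star_half]
        abel
      · have hik' : (⟨t i, hi⟩ : s) ≠ ⟨t k, hk⟩ := fun h => hik (congrArg Subtype.val h)
        rw [if_neg fun h => hik h.1, if_neg fun h => hik h.1.symm]
        simp [hik', Z, coe_star]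
    · rw [dif_neg fun h => hk h.2, if_neg fun h : t i = t k ∧ t i ∈ s => hk (h.1 ▸ h.2),
        if_neg fun h => hk h.2,
        hs2 _ _ hk, hs1 _ _ hk]
      simp
  · rw [dif_neg fun h => hi h.1, if_neg fun h => hi h.2,
      if_neg fun h : t k = t i ∧ t k ∈ s => hi (h.1 ▸ h.2),
      hs2 _ _ hi, hs1 _ _ hi]
    simp

variable {H : Type u} [NormedAddCommGroup H] [InnerProductSpace ℂ H]

/-- A functional with positive real part on matrices with positive real part is positive on
positive matrices. -/
theorem basisForm_nonneg (e : Module.Basis I ℂ H) {g : (I × I →₀ B) →ₗ[ℂ] ℂ}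
    (hg : ∀ Y, IsRealPositive Y → 0 ≤ (g Y).re) {n : ℕ} {M : Matrix (Fin n) (Fin n) B}
    (hM : B.MatPos M) (ξ : Fin n → H) : 0 ≤ ∑ i, ∑ k, basisForm e g (ξ i) (ξ k) (M i k) := by
  classical
  let s : Finset I := Finset.univ.biUnion fun i => (e.repr (ξ i)).support
  have hs : ∀ i, (e.repr (ξ i)).support ⊆ s := fun i =>
    Finset.subset_biUnion_of_mem (fun i => (e.repr (ξ i)).support) (Finset.mem_univ i)
  let Z : I → I → B := fun p q => ∑ i, ∑ k, (star (e.repr (ξ i) p) * e.repr (ξ k) q) • M i k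
  let Y : I × I →₀ B := ∑ p ∈ s, ∑ q ∈ s, Finsupp.single (p, q) (Z p q)
  have hgY : g Y = ∑ i, ∑ k, basisForm e g (ξ i) (ξ k) (M i k) := by
    have hgs : ∀ p q, g (Finsupp.single (p, q) (Z p q)) = ∑ i, ∑ k,
        (star (e.repr (ξ i) p) * e.repr (ξ k) q) * g (Finsupp.single (p, q) (M i k)) := by
      intro p q
      change (g ∘ₗ Finsupp.lsingle (p, q)) (Z p q) = _
      simp only [Z, map_sum, map_smul]
      rfl
    simp only [basisForm_apply_of_subset e g (hs _) (hs _), Y, map_sum, hgs]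
    rw [Finset.sum_congr rfl fun p _ => Finset.sum_comm, Finset.sum_comm]
    refine Finset.sum_congr rfl fun i _ => ?_
    rw [Finset.sum_congr rfl fun p _ => Finset.sum_comm, Finset.sum_comm]
  have hY : ∀ p q, Y (p, q) = Z p q := by
    intro p q
    have hZ : p ∉ s ∨ q ∉ s → Z p q = 0 := by
      intro h
      refine Finset.sum_eq_zero fun i _ => Finset.sum_eq_zero fun k _ => ?_
      rcases h with h | h
      · rw [Finsupp.notMem_support_iff.1 fun h' => h (hs i h'), star_zero, zero_mul, zero_smul]
      · rw [Finsupp.notMem_support_iff.1 fun h' => h (hs k h'), mul_zero, zero_smul]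
    simp only [Y, Finsupp.finsetSum_apply, Finsupp.single_apply, Prod.mk.injEq]
    by_cases hp : p ∈ s
    · by_cases hq : q ∈ s
      · rw [Finset.sum_eq_single p, Finset.sum_eq_single q]
        · simp
        · intro b _ hb
          rw [if_neg fun h => hb h.2]
        · exact fun h => (h hq).elim
        · intro b _ hb
          exact Finset.sum_eq_zero fun c _ => if_neg fun h => hb h.1
        · exact fun h => (h hp).elim
      · rw [hZ (Or.inr hq)]
        refine Finset.sum_eq_zero fun b _ => Finset.sum_eq_zero fun c hc => if_neg ?_
        rintro ⟨rfl, rfl⟩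
        exact hq hc
    · rw [hZ (Or.inl hp)]
      refine Finset.sum_eq_zero fun b hb => Finset.sum_eq_zero fun c _ => if_neg ?_
      rintro ⟨rfl, rfl⟩
      exact hp hb
  have hMstar : ∀ i k, star (M k i) = M i k := by
    intro i k
    exact Subtype.ext (congrFun (congrFun (IsGram.isHermitian (B := B.Ambient) hM) i) k)
  have hZstar : ∀ p q, star (Z q p) = Z p q := by
    intro p q
    simp only [Z, star_sum, star_smul, hMstar, star_mul', star_star]
    rw [Finset.sum_comm]
    refine Finset.sum_congr rfl fun i _ => Finset.sum_congr rfl fun k _ => ?_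
    rw [mul_comm]
  have hpos : IsRealPositive Y := by
    intro m t
    let V : Matrix (Fin n) (Fin m) B.Ambient :=
      Matrix.of fun i k => (e.repr (ξ i) (t k)) • (1 : B.Ambient)
    have h1 := IsGram.conj (B := B.Ambient) hM V
    refine matPos_iff_isGram.2 ?_
    convert h1.add h1 using 1
    have h2 : ∀ i k, (Z (t i) (t k) : B.Ambient)
        = (V.conjTranspose * (M.map fun x : B => (x : B.Ambient)) * V) i k := by
      intro i k
      simp only [Z, Matrix.mul_apply, Matrix.conjTranspose_apply, V, Matrix.of_apply,
        Matrix.map_apply, star_smul, star_one, Finset.smul_sum, smul_mul_assoc, one_mul,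
        mul_smul_comm, mul_one, Submodule.coe_sum, Submodule.coe_smul, smul_smul]
      rw [Finset.sum_comm]
      refine Finset.sum_congr rfl fun _ _ => Finset.sum_congr rfl fun _ _ => ?_
      rw [mul_comm]
    ext i k
    rw [Matrix.add_apply, ← h2]
    simp [doubleReal, hY, hZstar]
  rw [← hgY, Complex.nonneg_iff]
  refine ⟨hg Y hpos, ?_⟩
  -- `i Y` and `-i Y` are skew-adjoint, so that `g Y` is real.
  have hskew : ∀ c : ℂ, star c = -c → 0 ≤ (c * g Y).re := by
    intro c hc
    rw [← smul_eq_mul, ← map_smul]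
    refine hg _ (isRealPositive_of_skew fun i k => ?_)
    simp only [Finsupp.smul_apply, hY, star_smul, hc, hZstar, neg_smul]
  have h1 := hskew Complex.I (by simp)
  have h2 := hskew (-Complex.I) (by simp)
  simp at h1 h2
  linarith

variable [CompleteSpace H]

/-- The functional on finitely supported matrices that is given by a map into `B(H)`. -/
noncomputable def matrixFunctional (e : Module.Basis I ℂ H) (ψ : UCPMap A (operators H)) :
    (I × I →₀ A) →ₗ[ℂ] ℂ :=
  Finsupp.lsum ℂ fun p =>
    { toFun := fun a => ⟪e p.1, op (ψ a) (e p.2)⟫_ℂ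
      map_add' := fun a b => by
        rw [map_add]
        exact inner_add_right _ _ _
      map_smul' := fun c a => by
        rw [map_smul]
        exact inner_smul_right _ _ _ }

theorem matrixFunctional_single (e : Module.Basis I ℂ H) (ψ : UCPMap A (operators H)) (i k : I)
    (a : A) : matrixFunctional e ψ (Finsupp.single (i, k) a) = ⟪e i, op (ψ a) (e k)⟫_ℂ := by
  rw [matrixFunctional, Finsupp.lsum_single]
  rfl

theorem re_matrixFunctional_nonneg (e : Module.Basis I ℂ H) (ψ : UCPMap A (operators H))
    {X : I × I →₀ A} (hX : IsRealPositive X) : 0 ≤ (matrixFunctional e ψ X).re := by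
  classical
  let s : Finset I := X.support.image Prod.fst ∪ X.support.image Prod.snd
  let t : Fin s.card → I := fun i => (s.equivFin.symm i).1
  have hsum : ∀ f : I → ℂ, ∑ i, f (t i) = ∑ i ∈ s, f i := by
    intro f
    rw [← Finset.sum_coe_sort s f]
    exact Fintype.sum_equiv s.equivFin.symm (fun i => f (t i)) (fun i => f i.1) fun _ => rfl
  have hX1 : matrixFunctional e ψ X = ∑ i, ∑ k, ⟪e (t i), op (ψ (X (t i, t k))) (e (t k))⟫_ℂ := by
    have hsub : X.support ⊆ s ×ˢ s := fun p hp => Finset.mem_product.2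
      ⟨Finset.mem_union_left _ (Finset.mem_image_of_mem _ hp),
        Finset.mem_union_right _ (Finset.mem_image_of_mem _ hp)⟩
    rw [matrixFunctional, Finsupp.lsum_apply,
      Finsupp.sum_of_support_subset _ hsub _ fun p _ => map_zero _, Finset.sum_product, ← hsum]
    exact Finset.sum_congr rfl fun i _ => (hsum _).symm
  have h := matPos_operators_iff.1 (ψ.map_matPos _ _ (hX s.card t)) fun i => e (t i)
  have hadj : ∀ i k, ⟪e (t i), op (ψ (doubleReal X t i k)) (e (t k))⟫_ℂ
      = ⟪e (t i), op (ψ (X (t i, t k))) (e (t k))⟫_ℂ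
        + star ⟪e (t k), op (ψ (X (t k, t i))) (e (t i))⟫_ℂ := by
    intro i k
    have h1 : op (ψ (doubleReal X t i k)) = op (ψ (X (t i, t k)))
        + ContinuousLinearMap.adjoint (op (ψ (X (t k, t i)))) := by
      have h2 : ψ (doubleReal X t i k) = ψ (X (t i, t k)) + star (ψ (X (t k, t i))) := by
        rw [← ψ.map_star, ← map_add]
        rfl
      rw [h2]
      rfl
    rw [h1, _root_.add_apply, inner_add_right, ContinuousLinearMap.adjoint_inner_right,
      ← inner_conj_symm (op _ _)]
    rfl
  have h2 : 0 ≤ matrixFunctional e ψ X + star (matrixFunctional e ψ X) := by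
    refine h.trans_eq ?_
    rw [hX1]
    have : ∀ i k, ⟪e (t i), op ((doubleReal X t).map ψ.toLin i k) (e (t k))⟫_ℂ
      = ⟪e (t i), op (ψ (X (t i, t k))) (e (t k))⟫_ℂ
        + star ⟪e (t k), op (ψ (X (t k, t i))) (e (t i))⟫_ℂ := hadj
    simp only [this, Finset.sum_add_distrib, star_sum]
    congr 1
    exact Finset.sum_comm
  have h3 := (Complex.nonneg_iff.1 h2).1
  simp only [Complex.add_re, Complex.star_def, Complex.conj_re] at h3
  linarith

/-- **Arveson's extension theorem**: `B(H)` is injective among operator systems. A map `ψ` into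
`B(H)` is the same thing as a functional on finitely supported matrices indexed by a linear basis
of `H` that is positive on positive matrices, and such functionals extend by the theorem of
M. Riesz. -/
theorem exists_ucpMap_extension (φ : UCPMap A B) (hφ : φ.IsEmbedding)
    (ψ : UCPMap A (operators H)) : ∃ θ : UCPMap B (operators H), θ.comp φ = ψ := by
  classical
  let e := Module.Basis.ofVectorSpace ℂ H
  let I := Module.Basis.ofVectorSpaceIndex ℂ H
  let j : (I × I →₀ A) →ₗ[ℂ] (I × I →₀ B) := Finsupp.mapRange.linearMap φ.toLin
  have hj : ∀ X p, j X p = φ (X p) := fun X p => rfl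
  have hjs : ∀ p a, j (Finsupp.single p a) = Finsupp.single p (φ a) := fun p a =>
    Finsupp.mapRange_single (hf := map_zero φ.toLin)
  obtain ⟨g, hgj, hg⟩ := exists_complex_extension j
    (Finsupp.mapRange_injective _ (map_zero φ.toLin) hφ.1) (matrixFunctional e ψ)
    (P := IsRealPositive) (isRealPositive_of_skew (by simp)) (fun _ _ => IsRealPositive.add)
    (fun _ _ hr h => h.smul hr)
    (fun X hX => re_matrixFunctional_nonneg e ψ fun n t => hφ.2 n _ (by
      convert hX n t using 1
      ext i k
      simp [doubleReal, hj, φ.map_star]))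
    (fun Y => by
      obtain ⟨s, c, h⟩ := exists_isRealPositive_add Y
      refine ⟨∑ i ∈ s, Finsupp.single (i, i) ((c : ℂ) • (1 : A)), ?_⟩
      simpa only [map_sum, hjs, map_smul, φ.map_one] using h)
  have hform : ∀ ξ η a, basisForm e g ξ η (φ a) = ⟪ξ, op (ψ a) η⟫_ℂ := fun ξ η a =>
    basisForm_eq_inner e g (fun i k => by
      rw [← hjs, hgj, matrixFunctional_single]) ξ η
  obtain ⟨θ, hθ⟩ := exists_ucpMap_of_form (basisForm e g)
    (fun ξ ξ' η b => by rw [basisForm_add_left]; rfl)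
    (fun c ξ η b => by rw [basisForm_smul_left]; rfl)
    (fun ξ η η' b => by rw [basisForm_add_right]; rfl)
    (fun c ξ η b => by rw [basisForm_smul_right]; rfl)
    (fun ξ η => by
      rw [← φ.map_one, hform, ψ.map_one]
      rfl)
    (fun n M hM ξ => basisForm_nonneg e hg hM ξ)
  refine ⟨θ, UCPMap.ext fun a => Subtype.ext ?_⟩
  change op (θ (φ a)) = op (ψ a)
  ext η
  refine ext_inner_left ℂ fun ξ => ?_
  rw [hθ, hform]

end Arveson

/-! ### Operator systems on a common Hilbert space -/

section Representation

open scoped ComplexOrder InnerProductSpace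
open OperatorSystem

/-- Positive functionals separate the points of a C*-algebra: a nonzero element `-a* a` is separated
from the closed cone of elements with positive real part. -/
theorem exists_positiveLinearMap_ne_zero {B : Type*} [CStarAlgebra B] [PartialOrder B]
    [StarOrderedRing B] {a : B} (ha : a ≠ 0) : ∃ s : B →ₚ[ℂ] ℂ, s (star a * a) ≠ 0 := by
  let C : ProperCone ℝ B :=
    { carrier := {y | 0 ≤ y + star y}
      zero_mem' := by simp
      add_mem' := fun {y z} hy hz => by
        have h : 0 ≤ (y + star y) + (z + star z) := add_nonneg hy hz
        change 0 ≤ y + z + star (y + z)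
        rwa [star_add, add_add_add_comm]
      smul_mem' := fun r y hy => by
        have h : 0 ≤ (r : ℝ) • (y + star y) := smul_nonneg r.2 hy
        change 0 ≤ (r : ℝ) • y + star ((r : ℝ) • y)
        rwa [star_smul, star_trivial, ← smul_add]
      isClosed' := CStarAlgebra.isClosed_nonneg.preimage (continuous_id.add continuous_star) }
  have hmem : ∀ y, y ∈ C ↔ 0 ≤ y + star y := fun y => Iff.rfl
  have hC : -(star a * a) ∉ C := by
    rw [hmem]
    intro h
    have h1 : 0 ≤ star a * a := star_mul_self_nonneg a
    have h2 : star (-(star a * a)) = -(star a * a) := by simp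
    rw [h2, ← neg_add, neg_nonneg] at h
    have h3 : star a * a = 0 := le_antisymm ((le_add_of_nonneg_left h1).trans h) h1
    exact ha (CStarRing.star_mul_self_eq_zero_iff a |>.1 h3)
  obtain ⟨f, hf, hfa⟩ := C.hyperplane_separation_point hC
  let g : B →ₗ[ℂ] ℂ := Module.Dual.extendRCLike (𝕜 := ℂ) (f : B →ₗ[ℝ] ℝ)
  have hre : ∀ y, (g y).re = f y := fun y =>
    Module.Dual.re_extendRCLike_apply (𝕜 := ℂ) (f : B →ₗ[ℝ] ℝ) y
  have hskew : ∀ (c : ℂ) y, 0 ≤ y → star c = -c → 0 ≤ (c * g y).re := by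
    intro c y hy hc
    rw [← smul_eq_mul, ← map_smul, hre]
    refine hf _ ((hmem _).2 ?_)
    rw [star_smul, hc, (IsSelfAdjoint.of_nonneg hy).star_eq, neg_smul, add_neg_cancel]
  refine ⟨PositiveLinearMap.mk₀ g fun y hy => Complex.nonneg_iff.2 ⟨?_, ?_⟩, ?_⟩
  · rw [hre]
    refine hf _ ((hmem _).2 ?_)
    rw [(IsSelfAdjoint.of_nonneg hy).star_eq]
    exact add_nonneg hy hy
  · have h1 := hskew Complex.I y hy (by simp)
    have h2 := hskew (-Complex.I) y hy (by simp)
    simp at h1 h2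
    linarith
  · intro h
    have h1 : (g (star a * a)).re = 0 := by
      have h2 : g (star a * a) = 0 := h
      rw [h2, Complex.zero_re]
    rw [hre] at h1
    rw [map_neg, h1] at hfa
    simp at hfa

/-- The direct sum of a family of representations. -/
noncomputable def directSumRep {B : Type*} [CStarAlgebra B] {I : Type*} {K : I → Type*}
    [∀ i, NormedAddCommGroup (K i)] [∀ i, InnerProductSpace ℂ (K i)] [∀ i, CompleteSpace (K i)]
    (π : ∀ i, B →⋆ₐ[ℂ] (K i →L[ℂ] K i)) : B →⋆ₐ[ℂ] (lp K 2 →L[ℂ] lp K 2) where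
  toFun b := lp.mapCLM 2 (fun i => π i b) (norm_nonneg b) fun i =>
    NonUnitalStarAlgHom.norm_apply_le (π i) b
  map_one' := by
    ext x i
    simp
  map_mul' b c := by
    ext x i
    simp
  map_zero' := by
    ext x i
    simp
  map_add' b c := by
    ext x i
    simp
  commutes' r := by
    ext x i
    simp [Algebra.algebraMap_eq_smul_one]
  map_star' b := by
    rw [ContinuousLinearMap.star_eq_adjoint, ContinuousLinearMap.eq_adjoint_iff]
    intro x y
    rw [lp.inner_eq_tsum, lp.inner_eq_tsum]
    refine tsum_congr fun i => ?_
    change ⟪π i (star b) (x i), y i⟫_ℂ = ⟪x i, π i b (y i)⟫_ℂ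
    rw [map_star (π i), ContinuousLinearMap.star_eq_adjoint, ContinuousLinearMap.adjoint_inner_left]

theorem directSumRep_apply {B : Type*} [CStarAlgebra B] {I : Type*} {K : I → Type*}
    [∀ i, NormedAddCommGroup (K i)] [∀ i, InnerProductSpace ℂ (K i)] [∀ i, CompleteSpace (K i)]
    (π : ∀ i, B →⋆ₐ[ℂ] (K i →L[ℂ] K i)) (b : B) (x : lp K 2) (i : I) :
    directSumRep π b x i = π i b (x i) := rfl

/-- The **Gelfand–Naimark theorem**: the direct sum of all GNS representations is faithful. -/
theorem exists_injective_rep (B : Type u) [CStarAlgebra B] :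
    ∃ (K : Type u) (_ : NormedAddCommGroup K) (_ : InnerProductSpace ℂ K) (_ : CompleteSpace K)
      (π : B →⋆ₐ[ℂ] (K →L[ℂ] K)), Function.Injective π := by
  classical
  let _ := CStarAlgebra.spectralOrder B
  let _ := CStarAlgebra.spectralOrderedRing B
  refine ⟨lp (fun s : B →ₚ[ℂ] ℂ => s.GNS) 2, inferInstance, inferInstance, inferInstance,
    directSumRep fun s => s.gnsStarAlgHom, (injective_iff_map_eq_zero _).2 fun a ha => ?_⟩
  by_contra h
  obtain ⟨s, hs⟩ := exists_positiveLinearMap_ne_zero h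
  have h1 := directSumRep_apply (fun s : B →ₚ[ℂ] ℂ => s.gnsStarAlgHom) a
    (lp.single 2 s ((s.toPreGNS 1 : s.PreGNS) : s.GNS)) s
  rw [ha, lp.single_apply_self] at h1
  have h2 : ((s.toPreGNS a : s.PreGNS) : s.GNS) = 0 := by
    refine Eq.trans ?_ h1.symm
    change _ = s.gnsNonUnitalStarAlgHom a _
    rw [PositiveLinearMap.gnsNonUnitalStarAlgHom_apply_coe]
    simp
  refine hs ?_
  have h3 := s.preGNS_norm_sq (s.toPreGNS a)
  rw [← UniformSpace.Completion.norm_coe, h2] at h3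
  simpa using h3.symm

theorem nonneg_of_map_nonneg {B C F : Type*} [CStarAlgebra B] [PartialOrder B] [StarOrderedRing B]
    [CStarAlgebra C] [PartialOrder C] [StarOrderedRing C] [FunLike F B C] [AlgHomClass F ℂ B C]
    [StarHomClass F B C] (φ : F) (hφ : Function.Injective φ) {a : B} (ha : 0 ≤ φ a) : 0 ≤ a := by
  have hsa : IsSelfAdjoint a := hφ (by rw [map_star, (IsSelfAdjoint.of_nonneg ha).star_eq])
  rw [StarOrderedRing.nonneg_iff_spectrum_nonneg (R := ℝ) _, ← hsa.map_spectrum_real φ hφ]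
  exact (StarOrderedRing.nonneg_iff_spectrum_nonneg (R := ℝ) _).1 ha

/-- An injective *-homomorphism of C*-algebras preserves the spectra of self-adjoint matrices, so that
it reflects positivity of matrices. -/
theorem isGram_of_map {B C : Type*} [CStarAlgebra B] [CStarAlgebra C] (π : B →⋆ₐ[ℂ] C)
    (hπ : Function.Injective π) {n : Type*} [Fintype n] {M : Matrix n n B} (h : IsGram (M.map π)) :
    IsGram M := by
  classical
  let _ := CStarAlgebra.spectralOrder B
  let _ := CStarAlgebra.spectralOrderedRing B
  let _ := CStarAlgebra.spectralOrder C
  let _ := CStarAlgebra.spectralOrderedRing C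
  let f : CStarMatrix n n B →⋆ₙₐ[ℂ] CStarMatrix n n C :=
    CStarMatrix.mapₙₐ (π : B →⋆ₙₐ[ℂ] C)
  have hone : f 1 = 1 := by
    ext i j
    change π ((1 : Matrix n n B) i j) = (1 : Matrix n n C) i j
    rw [Matrix.one_apply, Matrix.one_apply]
    split_ifs <;> simp
  let φ : CStarMatrix n n B →⋆ₐ[ℂ] CStarMatrix n n C :=
    { f with
      map_one' := hone
      commutes' := fun r => by
        change f _ = _
        rw [Algebra.algebraMap_eq_smul_one, map_smul, hone, Algebra.algebraMap_eq_smul_one] }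
  rw [isGram_iff_nonneg] at h ⊢
  refine nonneg_of_map_nonneg φ (fun N N' hN => ?_) h
  ext i j
  exact hπ (congrFun (congrFun hN i) j)

theorem isGram_map {B C : Type*} [CStarAlgebra B] [CStarAlgebra C] (π : B →⋆ₐ[ℂ] C)
    {n : Type*} [Fintype n] {M : Matrix n n B} (h : IsGram M) : IsGram (M.map π) := by
  obtain ⟨N, rfl⟩ := h
  refine ⟨N.map π, ?_⟩
  ext i j
  simp only [Matrix.map_apply, Matrix.mul_apply, Matrix.conjTranspose_apply, map_sum, map_mul]
  exact Finset.sum_congr rfl fun k _ => by rw [map_star π]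

/-- The matrix coefficient of a representation at a pair of vectors. -/
noncomputable def matrixCoefficient {B : OperatorSystem.{u}} {K : Type*} [NormedAddCommGroup K]
    [InnerProductSpace ℂ K] [CompleteSpace K] (π : B.Ambient →⋆ₐ[ℂ] (K →L[ℂ] K)) (ξ η : K) :
    B →ₗ[ℂ] ℂ where
  toFun b := ⟪ξ, π b η⟫_ℂ
  map_add' b c := by
    rw [Submodule.coe_add, map_add, _root_.add_apply, inner_add_right]
  map_smul' r b := by
    rw [Submodule.coe_smul, map_smul, _root_.smul_apply, inner_smul_right]
    rfl

theorem posSemidef_matrixCoefficient {B : OperatorSystem.{u}} {K : Type*} [NormedAddCommGroup K]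
    [InnerProductSpace ℂ K] [CompleteSpace K] (π : B.Ambient →⋆ₐ[ℂ] (K →L[ℂ] K)) (ζ : K) {n : ℕ}
    {M : Matrix (Fin n) (Fin n) B} (hM : B.MatPos M) :
    (Matrix.of fun i j => matrixCoefficient π ζ ζ (M i j)).PosSemidef := by
  obtain ⟨N, hN⟩ := hM
  have h : (Matrix.of fun i j => matrixCoefficient π ζ ζ (M i j))
      = ∑ k, Matrix.gram ℂ fun j => π (N k j) ζ := by
    ext i j
    have h1 : (M i j : B.Ambient) = ∑ k, star (N k i) * N k j :=
      congrFun (congrFun hN i) j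
    rw [Matrix.sum_apply]
    change ⟪ζ, π (M i j) ζ⟫_ℂ = ∑ k, ⟪π (N k i) ζ, π (N k j) ζ⟫_ℂ
    rw [h1, map_sum, _root_.sum_apply, inner_sum]
    refine Finset.sum_congr rfl fun k _ => ?_
    rw [map_mul, map_star π, mul_apply_eq_comp, ContinuousLinearMap.star_eq_adjoint,
      ContinuousLinearMap.adjoint_inner_right]
  rw [h]
  exact Matrix.posSemidef_sum _ fun k _ => Matrix.posSemidef_gram ℂ _

/-- A faithful representation on one summand of a Hilbert sum extends to a complete order injection
into the operators on the whole sum, by a vector state on the orthogonal complement. -/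
theorem exists_embedding_lp {I : Type u} {K : I → Type u} [∀ i, NormedAddCommGroup (K i)]
    [∀ i, InnerProductSpace ℂ (K i)] [∀ i, CompleteSpace (K i)] (i : I) (B : OperatorSystem.{u})
    [Nontrivial B] (π : B.Ambient →⋆ₐ[ℂ] (K i →L[ℂ] K i)) (hπ : Function.Injective π) :
    ∃ ι : UCPMap B (operators (lp K 2)), ι.IsEmbedding := by
  classical
  obtain ⟨ζ, hζ⟩ : ∃ ζ : K i, ‖ζ‖ = 1 := by
    have h1 : (π 1 : K i →L[ℂ] K i) ≠ 0 := by
      intro h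
      have h2 : (1 : B.Ambient) = 0 := hπ (h.trans (map_zero π).symm)
      obtain ⟨b, hb⟩ := exists_ne (0 : B)
      refine hb (Subtype.ext ?_)
      rw [← mul_one (b : B.Ambient), h2, mul_zero]
      rfl
    obtain ⟨ζ, hζ⟩ : ∃ ζ : K i, ζ ≠ 0 := by
      by_contra! h
      exact h1 (ContinuousLinearMap.ext fun x => by rw [h x, map_zero, map_zero])
    exact ⟨_, norm_smul_inv_norm (𝕜 := ℂ) hζ⟩
  have hone : ∀ x y : K i, matrixCoefficient π x y 1 = ⟪x, y⟫_ℂ := fun x y => by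
    change ⟪x, π 1 y⟫_ℂ = _
    rw [map_one]
    rfl
  have hpos : ∀ (n : ℕ) (M : Matrix (Fin n) (Fin n) B), B.MatPos M → ∀ x : Fin n → K i,
      0 ≤ ∑ k, ∑ l, matrixCoefficient π (x k) (x l) (M k l) := fun n M hM =>
    isGram_iff_inner_nonneg.1 (isGram_map π (matPos_iff_isGram.1 hM))
  obtain ⟨ι, hι⟩ := exists_ucpMap_of_form (H := lp K 2) (B := B)
    (fun ξ η => matrixCoefficient π (ξ i) (η i)
      + (⟪ξ, η⟫_ℂ - ⟪ξ i, η i⟫_ℂ) • matrixCoefficient π ζ ζ)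
    (fun ξ ξ' η b => by
      simp only [LinearMap.add_apply, LinearMap.smul_apply, smul_eq_mul, matrixCoefficient,
        LinearMap.coe_mk, AddHom.coe_mk, lp.coeFn_add, Pi.add_apply, inner_add_left]
      ring)
    (fun c ξ η b => by
      simp only [LinearMap.add_apply, LinearMap.smul_apply, smul_eq_mul, matrixCoefficient,
        LinearMap.coe_mk, AddHom.coe_mk, lp.coeFn_smul, Pi.smul_apply, inner_smul_left,
        Complex.star_def]
      ring)
    (fun ξ η η' b => by
      simp only [LinearMap.add_apply, LinearMap.smul_apply, smul_eq_mul, matrixCoefficient,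
        LinearMap.coe_mk, AddHom.coe_mk, lp.coeFn_add, Pi.add_apply, inner_add_right, map_add]
      ring)
    (fun c ξ η b => by
      simp only [LinearMap.add_apply, LinearMap.smul_apply, smul_eq_mul, matrixCoefficient,
        LinearMap.coe_mk, AddHom.coe_mk, lp.coeFn_smul, Pi.smul_apply, inner_smul_right, map_smul]
      ring)
    (fun ξ η => by
      rw [LinearMap.add_apply, LinearMap.smul_apply, hone, hone, inner_self_eq_norm_sq_to_K, hζ]
      simp)
    (fun n M hM ξ => by
      simp only [LinearMap.add_apply, Finset.sum_add_distrib]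
      refine add_nonneg (hpos n M hM fun k => ξ k i) ?_
      -- The second summand is a Schur product with the Gram matrix of the components of the
      -- vectors in the orthogonal complement of the summand.
      let v : Fin n → lp K 2 := fun k => ξ k - lp.single 2 i (ξ k i)
      have hv : ∀ k l, ⟪v k, v l⟫_ℂ = ⟪ξ k, ξ l⟫_ℂ - ⟪ξ k i, ξ l i⟫_ℂ := by
        intro k l
        simp only [v, inner_sub_left, inner_sub_right, lp.inner_single_left,
          lp.inner_single_right, lp.single_apply_self]
        ring
      have h := ((Matrix.posSemidef_gram ℂ v).hadamard
        (posSemidef_matrixCoefficient π ζ hM)).dotProduct_mulVec_nonneg 1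
      simpa [dotProduct, Matrix.mulVec, Matrix.hadamard_apply, Matrix.gram_apply, hv] using h)
  refine ⟨ι, UCPMap.isEmbedding_of_reflects fun n M hM => ?_⟩
  refine matPos_iff_isGram.2 (isGram_of_map π hπ (isGram_iff_inner_nonneg.2 fun x => ?_))
  have h := matPos_operators_iff.1 hM fun k => lp.single 2 i (x k)
  refine h.trans_eq (Finset.sum_congr rfl fun k _ => Finset.sum_congr rfl fun l _ => ?_)
  refine (hι _ _ _).trans ?_
  rw [LinearMap.add_apply, LinearMap.smul_apply, lp.inner_single_left, lp.single_apply_self,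
    lp.single_apply_self, sub_self, zero_smul, add_zero]
  rfl

/-- All nonzero members of a family of operator systems embed into the operators on a common
Hilbert space. -/
theorem exists_common_embedding {I : Type u} (A : I → OperatorSystem.{u}) :
    ∃ (H : Type u) (_ : NormedAddCommGroup H) (_ : InnerProductSpace ℂ H) (_ : CompleteSpace H),
      ∀ i, Nontrivial (A i) → ∃ ι : UCPMap (A i) (operators H), ι.IsEmbedding := by
  choose K i₁ i₂ i₃ π hπ using fun i => exists_injective_rep (A i).Ambient
  exact ⟨lp K 2, inferInstance, inferInstance, inferInstance, fun i _ =>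
    exists_embedding_lp i (A i) (π i) (hπ i)⟩

end Representation

/-! ### Pointwise limits of maps into `B(H)` -/

section Limits

open scoped ComplexOrder InnerProductSpace
open OperatorSystem Filter Topology

variable {H : Type u} [NormedAddCommGroup H] [InnerProductSpace ℂ H] [CompleteSpace H]

theorem norm_inner_op_le (T : operators H) (ξ η : H) : ‖⟪ξ, op T η⟫_ℂ‖ ≤ ‖T‖ * ‖ξ‖ * ‖η‖ := by
  refine (norm_inner_le_norm ξ _).trans ?_
  have h : ‖op T η‖ ≤ ‖T‖ * ‖η‖ := (op T).le_opNorm η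
  calc ‖ξ‖ * ‖op T η‖ ≤ ‖ξ‖ * (‖T‖ * ‖η‖) := mul_le_mul_of_nonneg_left h (norm_nonneg _)
    _ = ‖T‖ * ‖ξ‖ * ‖η‖ := by ring

/-- The unital completely positive maps into `B(H)` are compact in the point-weak operator
topology. -/
theorem exists_tendsto_inner {B : OperatorSystem.{u}} {I : Type*} (U : Ultrafilter I)
    (f : I → UCPMap B (operators H)) :
    ∃ θ : UCPMap B (operators H), ∀ b ξ η,
      Tendsto (fun i => ⟪ξ, op (f i b) η⟫_ℂ) (U : Filter I) (𝓝 ⟪ξ, op (θ b) η⟫_ℂ) := by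
  have key : ∀ b ξ η, ∃ z : ℂ, Tendsto (fun i => ⟪ξ, op (f i b) η⟫_ℂ) (U : Filter I) (𝓝 z) := by
    intro b ξ η
    have hle : ∀ i, ⟪ξ, op (f i b) η⟫_ℂ ∈ Metric.closedBall (0 : ℂ) (‖b‖ * ‖ξ‖ * ‖η‖) := by
      intro i
      rw [mem_closedBall_zero_iff]
      refine (norm_inner_op_le _ ξ η).trans ?_
      gcongr
      exact (f i).norm_map_le b
    obtain ⟨z, -, hz⟩ := (isCompact_closedBall (0 : ℂ) (‖b‖ * ‖ξ‖ * ‖η‖)).ultrafilter_le_nhds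
      (U.map fun i => ⟪ξ, op (f i b) η⟫_ℂ)
      (le_principal_iff.2 (Filter.mem_map.2 (univ_mem' hle)))
    exact ⟨z, hz⟩
  choose S hS using key
  let L : H → H → B →ₗ[ℂ] ℂ := fun ξ η =>
    { toFun := fun b => S b ξ η
      map_add' := fun b c => tendsto_nhds_unique (hS _ ξ η) <| by
        refine ((hS b ξ η).add (hS c ξ η)).congr fun i => ?_
        rw [map_add, ← inner_add_right]
        rfl
      map_smul' := fun r b => tendsto_nhds_unique (hS _ ξ η) <| by
        refine ((hS b ξ η).const_mul r).congr fun i => ?_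
        rw [map_smul, ← inner_smul_right]
        rfl }
  obtain ⟨θ, hθ⟩ := exists_ucpMap_of_form L
    (fun ξ ξ' η b => tendsto_nhds_unique (hS b _ η) <| by
      refine ((hS b ξ η).add (hS b ξ' η)).congr fun i => ?_
      rw [inner_add_left])
    (fun c ξ η b => tendsto_nhds_unique (hS b _ η) <| by
      refine ((hS b ξ η).const_mul (star c)).congr fun i => ?_
      rw [inner_smul_left]
      rfl)
    (fun ξ η η' b => tendsto_nhds_unique (hS b ξ _) <| by
      refine ((hS b ξ η).add (hS b ξ η')).congr fun i => ?_
      rw [map_add, inner_add_right])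
    (fun c ξ η b => tendsto_nhds_unique (hS b ξ _) <| by
      refine ((hS b ξ η).const_mul c).congr fun i => ?_
      rw [map_smul, inner_smul_right])
    (fun ξ η => tendsto_nhds_unique (hS 1 ξ η) <| by
      refine tendsto_const_nhds.congr fun i => ?_
      rw [(f i).map_one]
      rfl)
    (fun n M hM ξ => by
      refine ge_of_tendsto' (tendsto_finsetSum _ fun k _ => tendsto_finsetSum _ fun l _ =>
        hS (M k l) (ξ k) (ξ l)) fun i => ?_
      exact matPos_operators_iff.1 ((f i).map_matPos n M hM) ξ)
  refine ⟨θ, fun b ξ η => ?_⟩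
  rw [hθ]
  exact hS b ξ η

end Limits

/-! ### Systems of bounded functions -/

section FreeModel

open scoped ComplexOrder InnerProductSpace
open OperatorSystem Filter Topology

variable {G : Type u} [Groupoid.{u} G]

/-- A description of `W` as a system of all bounded `B(H)`-valued functions on the range fibers,
restricted to those arrows whose source satisfies `p`. Positivity is pointwise, all bounded
functions occur, and the action is by translation. -/
structure FreeModel (W : GroupoidDynamicalSystem G) (H : Type u) [NormedAddCommGroup H]
    [InnerProductSpace ℂ H] [CompleteSpace H] (p : G → Prop) where
  /-- The evaluation at an arrow. -/
  ev : ∀ {x : G} (k : RangeFiber x), p k.source → UCPMap (W.fiber x) (operators H)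
  ev_act : ∀ {x y : G} (g : x ⟶ y) (k : RangeFiber y) (hk : p k.source) (w : W.fiber x),
    ev k hk (W.act g w) = ev (RangeFiber.invMul g k) hk w
  reflects : ∀ {x : G} {n : ℕ} (M : Matrix (Fin n) (Fin n) (W.fiber x)),
    (∀ (k : RangeFiber x) (hk : p k.source), (operators H).MatPos (M.map (ev k hk).toLin)) →
      (W.fiber x).MatPos M
  exists_of_bounded : ∀ {x : G} (F : ∀ k : RangeFiber x, p k.source → operators H) (c : ℝ),
    (∀ k hk, ‖F k hk‖ ≤ c) → ∃ w : W.fiber x, ∀ k hk, ev k hk w = F k hk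

namespace FreeModel

variable {W : GroupoidDynamicalSystem G} {H : Type u} [NormedAddCommGroup H]
  [InnerProductSpace ℂ H] [CompleteSpace H] {p : G → Prop} (F : FreeModel W H p)

include F in
theorem norm_le {x : G} {w : W.fiber x} {c : ℝ} (hc : 0 ≤ c)
    (h : ∀ (k : RangeFiber x) (hk : p k.source), ‖F.ev k hk w‖ ≤ c) : ‖w‖ ≤ c := by
  refine (matPos_iff_norm_le hc).1 (F.reflects _ fun k hk => ?_)
  rw [UCPMap.map_fin_two, UCPMap.map_star]
  exact (matPos_iff_norm_le hc).2 (h k hk)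

include F in
theorem ext {x : G} {w w' : W.fiber x}
    (h : ∀ (k : RangeFiber x) (hk : p k.source), F.ev k hk w = F.ev k hk w') : w = w' := by
  rw [← sub_eq_zero, ← norm_le_zero_iff]
  refine F.norm_le le_rfl fun k hk => ?_
  rw [map_sub, h, sub_self, norm_zero]

theorem exists_ucpMap {B : OperatorSystem.{u}} {x : G}
    (θ : ∀ k : RangeFiber x, p k.source → UCPMap B (operators H)) :
    ∃ ψ : UCPMap B (W.fiber x), ∀ k hk b, F.ev k hk (ψ b) = θ k hk b := by
  choose ψ hψ using fun b : B => F.exists_of_bounded (fun k hk => θ k hk b) ‖b‖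
    fun k hk => (θ k hk).norm_map_le b
  refine ⟨⟨⟨⟨ψ, fun b c => F.ext fun k hk => ?_⟩, fun r b => F.ext fun k hk => ?_⟩,
    F.ext fun k hk => ?_, fun n M hM => F.reflects _ fun k hk => ?_⟩, fun k hk b => hψ b k hk⟩
  · rw [map_add, hψ, hψ, hψ, map_add]
  · rw [map_smul, hψ, hψ, map_smul]
    rfl
  · rw [(F.ev k hk).map_one]
    exact (hψ 1 k hk).trans (θ k hk).map_one
  · convert (θ k hk).map_matPos n M hM using 1
    ext1 i j
    exact hψ (M i j) k hk

/-- A `G`-morphism into `W` is the same thing as an equivariant family of maps into `B(H)`. -/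
theorem exists_morphism {B : GroupoidDynamicalSystem G}
    (θ : ∀ {x : G} (k : RangeFiber x), p k.source → UCPMap (B.fiber x) (operators H))
    (hθ : ∀ {x y : G} (g : x ⟶ y) (k : RangeFiber y) (hk : p k.source) (b : B.fiber x),
      θ k hk (B.act g b) = θ (RangeFiber.invMul g k) hk b) :
    ∃ Ψ : Morphism B W, ∀ {x : G} (k : RangeFiber x) (hk : p k.source) (b : B.fiber x),
      F.ev k hk (Ψ.app x b) = θ k hk b := by
  choose ψ hψ using fun x : G => F.exists_ucpMap (x := x) fun k hk => θ k hk
  refine ⟨⟨ψ, fun {x y} g b => F.ext fun k hk => ?_⟩, fun k hk b => hψ _ k hk b⟩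
  exact (F.ev_act g k hk _).trans ((hψ x (RangeFiber.invMul g k) hk b).trans
    ((hθ g k hk b).symm.trans (hψ y k hk _).symm))

/-- Coinduction: maps of the fibers of `B` into `B(H)` give a `G`-morphism of `B` into `W`. -/
theorem exists_coinduced {B : GroupoidDynamicalSystem G}
    (τ : ∀ v : G, p v → UCPMap (B.fiber v) (operators H)) :
    ∃ Ψ : Morphism B W, ∀ {x : G} (k : RangeFiber x) (hk : p k.source) (b : B.fiber x),
      F.ev k hk (Ψ.app x b) = τ k.source hk (B.act (Groupoid.inv k.hom) b) := by
  refine F.exists_morphism (fun k hk => (τ k.source hk).comp (B.act (Groupoid.inv k.hom))) ?_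
  intro x y g k hk b
  rw [UCPMap.comp_apply, B.act_mul]
  have h : Groupoid.inv (k.hom ≫ Groupoid.inv g) = g ≫ Groupoid.inv k.hom := by simp
  change _ = τ k.source hk (B.act (Groupoid.inv (k.hom ≫ Groupoid.inv g)) b)
  rw [h]

theorem ev_eq_ev_act {x : G} (k : RangeFiber x) (hk : p k.source) (w : W.fiber x) :
    F.ev k hk w = F.ev (⟨k.source, 𝟙 k.source⟩ : RangeFiber k.source) hk
      (W.act (Groupoid.inv k.hom) w) := by
  rw [F.ev_act]
  simp [RangeFiber.invMul]

include F in
/-- `W` is injective: by coinduction, an extension problem is solved by Arveson's theorem on each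
fiber. -/
theorem isInjective : W.IsInjective := by
  intro A B Φ hΦ Ψ
  choose τ hτ using fun (v : G) (hv : p v) => exists_ucpMap_extension (Φ.app v) (hΦ v)
    ((F.ev (⟨v, 𝟙 v⟩ : RangeFiber v) hv).comp (Ψ.app v))
  obtain ⟨Θ, hΘ⟩ := F.exists_coinduced τ
  refine ⟨Θ, Morphism.ext_apply fun x a => F.ext fun k hk => ?_⟩
  rw [Morphism.comp_apply, hΘ, Φ.equivariant, ← UCPMap.comp_apply, hτ, UCPMap.comp_apply,
    ← Ψ.equivariant, ← F.ev_eq_ev_act]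

/-- A `G`-morphism that is coinduced by complete order injections is a `G`-embedding. -/
theorem isEmbedding_coinduced {A : GroupoidDynamicalSystem G}
    {τ : ∀ v : G, p v → UCPMap (A.fiber v) (operators H)} (hτ : ∀ v hv, (τ v hv).IsEmbedding)
    (hp : ∀ v, ¬ p v → Subsingleton (A.fiber v)) {J : Morphism A W}
    (hJ : ∀ {x : G} (k : RangeFiber x) (hk : p k.source) (a : A.fiber x),
      F.ev k hk (J.app x a) = τ k.source hk (A.act (Groupoid.inv k.hom) a)) : J.IsEmbedding := by
  intro x
  refine UCPMap.isEmbedding_of_reflects fun n M hM => ?_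
  by_cases hx : p x
  · refine (hτ x hx).2 n M ?_
    have h := (F.ev (⟨x, 𝟙 x⟩ : RangeFiber x) hx).map_matPos n _ hM
    convert h using 1
    ext1 i j
    refine Eq.trans ?_ (hJ (⟨x, 𝟙 x⟩ : RangeFiber x) hx (M i j)).symm
    simp [act_id]
  · have := hp x hx
    exact matPos_of_subsingleton M

include F in
theorem hasUltralimits : HasUltralimits W := by
  intro U
  choose θ hθ using fun {x : G} (k : RangeFiber x) (hk : p k.source) =>
    exists_tendsto_inner U fun Φ : Morphism W W => (F.ev k hk).comp (Φ.app x)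
  obtain ⟨Ψ, hΨ⟩ := F.exists_morphism θ (by
    intro x y g k hk w
    refine Subtype.ext (?_ : op _ = op _)
    ext η
    refine ext_inner_left ℂ fun ξ => ?_
    refine tendsto_nhds_unique (hθ k hk _ ξ η) ((hθ (RangeFiber.invMul g k) hk w ξ η).congr ?_)
    intro Φ
    rw [UCPMap.comp_apply, UCPMap.comp_apply, ← Φ.equivariant, F.ev_act])
  refine ⟨Ψ, fun x w v c h => ?_⟩
  obtain ⟨Φ₀, hΦ₀⟩ := h.exists
  have hc : 0 ≤ c := (norm_nonneg _).trans hΦ₀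
  refine F.norm_le hc fun k hk => norm_le_of_norm_inner_le (T := op (F.ev k hk _)) hc ?_
  intro ξ η
  have hlim : Tendsto (fun Φ : Morphism W W => ⟪ξ, op (F.ev k hk (Φ.app x w - v)) η⟫_ℂ) U
      (𝓝 ⟪ξ, op (F.ev k hk (Ψ.app x w - v)) η⟫_ℂ) := by
    have hsub : ∀ b : W.fiber x, ⟪ξ, op (F.ev k hk (b - v)) η⟫_ℂ
        = ⟪ξ, op (F.ev k hk b) η⟫_ℂ - ⟪ξ, op (F.ev k hk v) η⟫_ℂ := by
      intro b
      rw [map_sub, ← inner_sub_right]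
      rfl
    simp only [hsub, hΨ]
    exact (hθ k hk w ξ η).sub_const _
  refine le_of_tendsto hlim.norm (h.mono fun Φ hΦ => ?_)
  refine (norm_inner_op_le _ ξ η).trans ?_
  gcongr
  exact ((F.ev k hk).norm_map_le _).trans hΦ

end FreeModel

end FreeModel

/-! ### Models of systems of bounded functions -/

section Evaluation

open OperatorSystem

variable {X B : Type u} [TopologicalSpace X] [CStarAlgebra B]

/-- The evaluation of bounded functions at a point. -/
noncomputable def UCPMap.eval (x : X) :
    UCPMap (ofCStarAlgebra (X →ᵇ B)) (ofCStarAlgebra B) :=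
  UCPMap.ofStarAlgHom
    { toFun := fun f => f x
      map_one' := rfl
      map_mul' := fun _ _ => rfl
      map_zero' := rfl
      map_add' := fun _ _ => rfl
      commutes' := fun _ => rfl
      map_star' := fun _ => rfl }

theorem matPos_of_eval [DiscreteTopology X] {n : ℕ}
    {M : Matrix (Fin n) (Fin n) (ofCStarAlgebra (X →ᵇ B))}
    (h : ∀ x, (ofCStarAlgebra B).MatPos (M.map (UCPMap.eval x).toLin)) :
    (ofCStarAlgebra (X →ᵇ B)).MatPos M :=
  isGram_boundedFunction_iff.2 h

theorem exists_eval_eq [DiscreteTopology X] (F : X → ofCStarAlgebra B) (c : ℝ)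
    (h : ∀ x, ‖F x‖ ≤ c) : ∃ w : ofCStarAlgebra (X →ᵇ B), ∀ x, UCPMap.eval x w = F x :=
  let w : (⊤ : Submodule ℂ (X →ᵇ B)) :=
    ⟨BoundedContinuousFunction.ofNormedAddCommGroupDiscrete (fun x => (F x).1) c h,
      Submodule.mem_top⟩
  ⟨w, fun _ => rfl⟩

end Evaluation

namespace GroupoidDynamicalSystem

open OperatorSystem

variable {G : Type u} [Groupoid.{u} G]

/-- The system of all bounded functions on the whole range fibers. -/
noncomputable def ellInftyModel (H : Type u) [NormedAddCommGroup H] [InnerProductSpace ℂ H]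
    [CompleteSpace H] : FreeModel (ellInfty G H) H fun _ => True where
  ev k _ := UCPMap.eval k
  ev_act _ _ _ _ := rfl
  reflects _ h := matPos_of_eval fun k => h k trivial
  exists_of_bounded F c h := by
    obtain ⟨w, hw⟩ := exists_eval_eq (fun k => F k trivial) c fun k => h k trivial
    exact ⟨w, fun k _ => hw k⟩

/-- The arrows with range `x` whose source satisfies `p`. -/
abbrev RestrictedFiber (p : G → Prop) (x : G) : Type u := {k : RangeFiber x // p k.source}

section Restricted

variable (H : Type u) [NormedAddCommGroup H] [InnerProductSpace ℂ H] [CompleteSpace H]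
  (p : G → Prop)

/-- Translation of bounded functions on arrows whose source satisfies `p`. -/
noncomputable def restrictedTranslate {x y : G} (g : x ⟶ y) :
    (RestrictedFiber p x →ᵇ (H →L[ℂ] H)) →⋆ₐ[ℂ] (RestrictedFiber p y →ᵇ (H →L[ℂ] H)) where
  toFun := fun f => f.compContinuous
    ⟨fun k => ⟨RangeFiber.invMul g k.1, k.2⟩, continuous_of_discreteTopology⟩
  map_one' := rfl
  map_mul' := fun _ _ => rfl
  map_zero' := rfl
  map_add' := fun _ _ => rfl
  commutes' := fun _ => rfl
  map_star' := fun _ => rfl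

theorem restrictedTranslate_comp {x y z : G} (h : x ⟶ y) (g : y ⟶ z)
    (f : RestrictedFiber p x →ᵇ (H →L[ℂ] H)) :
    restrictedTranslate H p g (restrictedTranslate H p h f)
      = restrictedTranslate H p (h ≫ g) f := by
  ext1 k
  change f _ = f _
  congr 1
  simp [RangeFiber.invMul]

theorem restrictedTranslate_id {x : G} (f : RestrictedFiber p x →ᵇ (H →L[ℂ] H)) :
    restrictedTranslate H p (𝟙 x) f = f := by
  ext1 k
  change f _ = f _
  congr 1
  simp [RangeFiber.invMul]

/-- The system of all bounded `B(H)`-valued functions on the arrows whose source satisfies `p`. Its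
fiber at `x` is zero if no such arrow has range `x`. -/
noncomputable def restrictedEllInfty : GroupoidDynamicalSystem G where
  fiber := fun x => OperatorSystem.ofCStarAlgebra (RestrictedFiber p x →ᵇ (H →L[ℂ] H))
  act := fun g => UCPMap.ofStarAlgHom (restrictedTranslate H p g)
  act_isIso := by
    intro x y g
    apply UCPMap.ofStarAlgHom_isIso _ (restrictedTranslate H p (Groupoid.inv g))
    · intro f
      rw [restrictedTranslate_comp, Groupoid.comp_inv, restrictedTranslate_id]
    · intro f
      rw [restrictedTranslate_comp, Groupoid.inv_comp, restrictedTranslate_id]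
  act_mul := fun h g f => Subtype.ext (restrictedTranslate_comp H p h g f.1)

/-- `restrictedEllInfty` consists, by construction, of all bounded functions on the restricted range
fibers. -/
noncomputable def restrictedModel : FreeModel (restrictedEllInfty H p) H p where
  ev k hk := UCPMap.eval (⟨k, hk⟩ : RestrictedFiber p _)
  ev_act _ _ _ _ := rfl
  reflects _ h := matPos_of_eval fun k => h k.1 k.2
  exists_of_bounded {x} F c h := by
    obtain ⟨w, hw⟩ := exists_eval_eq (fun k : RestrictedFiber p x => F k.1 k.2) c
      fun k => h k.1 k.2
    exact ⟨w, fun k hk => hw ⟨k, hk⟩⟩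

end Restricted

/-! ### Injective envelopes -/

/-- Every system embeds into a system of bounded functions. Fibers that are zero have no unital
embedding into `B(H)`, so that the arrows that start there are left out. The range of an endomorphism with minimal seminorm is
the required extension. -/
theorem exists_rigid_injective_extension (A : GroupoidDynamicalSystem G) :
    ∃ (R : GroupoidDynamicalSystem G) (ρ : Morphism A R),
      ρ.IsEmbedding ∧ R.IsInjective ∧ ρ.IsRigid := by
  obtain ⟨H, _, _, _, h⟩ := exists_common_embedding A.fiber
  choose ι hι using h
  let F := restrictedModel H fun v : G => Nontrivial (A.fiber v)
  obtain ⟨J, hJ⟩ := F.exists_coinduced (B := A) ι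
  have hJe : J.IsEmbedding :=
    F.isEmbedding_coinduced hι (fun _ => not_nontrivial_iff_subsingleton.1) hJ
  obtain ⟨Φ, hΦ, -⟩ := F.hasUltralimits.exists_isMinimalSeminorm_le J (Morphism.id _)
    (Morphism.id_comp J)
  obtain ⟨S, Υ, -, -, h1, h2, h3⟩ := hΦ.exists_range F.hasUltralimits F.isInjective hJe
  exact ⟨S.toSystem, Υ, h1, h2, h3⟩

end GroupoidDynamicalSystem

theorem mainTheorem2 {G : Type u} [Groupoid.{u} G] (A : GroupoidDynamicalSystem G) :
    -- existence
    (∃ (I : GroupoidDynamicalSystem G) (Υ : Morphism A I), IsInjectiveEnvelope Υ) ∧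
    -- uniqueness
    (∀ (I B : GroupoidDynamicalSystem G) (Υ : Morphism A I) (Φ : Morphism A B),
      IsInjectiveEnvelope Υ → IsInjectiveEnvelope Φ →
      ∃ Ψ : Morphism I B, Ψ.IsIso ∧ Ψ.comp Υ = Φ) ∧
    -- minimality, essentiality and rigidity of injective extensions are the same
    (∀ (B : GroupoidDynamicalSystem G) (Φ : Morphism A B), Φ.IsEmbedding → B.IsInjective →
      (IsInjectiveEnvelope Φ ↔ Φ.IsEssential) ∧ (IsInjectiveEnvelope Φ ↔ Φ.IsRigid)) ∧
    -- all fibers are operator systems on a common Hilbert space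
    ((∀ x, Nontrivial (A.fiber x)) →
      ∃ (H : Type u) (_ : NormedAddCommGroup H) (_ : InnerProductSpace ℂ H) (_ : CompleteSpace H)
        (ι : ∀ x, UCPMap (A.fiber x) (OperatorSystem.ofCStarAlgebra (H →L[ℂ] H))),
        ∀ x, (ι x).IsEmbedding) ∧
    -- the envelope is the range of a minimal projection
    (∀ (H : Type u) [NormedAddCommGroup H] [InnerProductSpace ℂ H] [CompleteSpace H]
      (ι : ∀ x, UCPMap (A.fiber x) (OperatorSystem.ofCStarAlgebra (H →L[ℂ] H))),
      (∀ x, (ι x).IsEmbedding) →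
      ∃ J : Morphism A (ellInfty G H),
        (∀ (x : G) (a : A.fiber x) (k : RangeFiber x),
          ellInftyEval H (J.app x a) k
            = (ι k.source (A.act (Groupoid.inv k.hom) a)).1) ∧
        J.IsEmbedding ∧
        (∃ Θ, IsMinimalProjection J Θ) ∧
        ∀ Θ, IsMinimalProjection J Θ →
          ∃ (S : Subsystem (ellInfty G H)) (Υ : Morphism A S.toSystem),
            S.IsRange Θ ∧
            (∀ (x : G) (a : A.fiber x), S.incl x (Υ.app x a) = J.app x a) ∧
            IsInjectiveEnvelope Υ) := by
  obtain ⟨R, ρ, hρ, hR, hr⟩ := exists_rigid_injective_extension A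
  refine ⟨⟨R, ρ, isInjectiveEnvelope_of_isRigid hρ hR hr⟩, ?_, ?_, ?_, ?_⟩
  · intro I B Υ Φ hΥ hΦ
    exact hΥ.exists_isIso hΦ (hΥ.isRigid hρ hR hr)
  · intro B Φ hΦ hB
    have rigid_iff : IsInjectiveEnvelope Φ ↔ Φ.IsRigid :=
      ⟨fun h => h.isRigid hρ hR hr, isInjectiveEnvelope_of_isRigid hΦ hB⟩
    exact ⟨⟨fun h => (rigid_iff.1 h).isEssential hB,
      fun h => rigid_iff.2 (h.isRigid hΦ hB hρ hR hr)⟩, rigid_iff⟩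
  · intro hA
    obtain ⟨H, i₁, i₂, i₃, h⟩ := exists_common_embedding A.fiber
    choose ι hι using h
    exact ⟨H, i₁, i₂, i₃, fun x => ι x (hA x), fun x => hι x (hA x)⟩
  · intro H _ _ _ ι hι
    let F : FreeModel (ellInfty G H) H fun _ => True := ellInftyModel H
    obtain ⟨J, hJ⟩ := F.exists_coinduced (B := A) fun v _ => ι v
    have hJe : J.IsEmbedding :=
      F.isEmbedding_coinduced (fun v _ => hι v) (fun _ h => (h trivial).elim) hJ
    refine ⟨J, fun x a k => congrArg Subtype.val (hJ k trivial a), hJe, ?_, fun Θ hΘ => ?_⟩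
    · obtain ⟨Φ, hΦ, -⟩ := F.hasUltralimits.exists_isMinimalSeminorm_le J (Morphism.id _)
        (Morphism.id_comp J)
      exact ⟨Φ, hΦ.isMinimalProjection F.hasUltralimits⟩
    · obtain ⟨S, Υ, h1, h2, h3, h4, h5⟩ := (hΘ.isMinimalSeminorm F.hasUltralimits).exists_range
        F.hasUltralimits F.isInjective hJe
      exact ⟨S, Υ, h1, fun x a => Morphism.congr_apply h2 x a,
        isInjectiveEnvelope_of_isRigid h3 h4 h5⟩
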